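/- Let $N\ge 2$, $\omega=e^{2\pi i/N}$, $\epsilon=(-1)^N$, $n\ge 2$. Let $V_1,\dots,V_n$ be $N$-dimensional spaces with bases $|\gamma\rangle$, $\gamma\in\mathbb Z_N$, and let $u_k,v_k$ act on the $k$-th factor of $V_1\otimes\cdots\otimes V_n$ by $u_k|\gamma\rangle=\omega^{\gamma}|\gamma\rangle$, $v_k|\gamma\rangle=|\gamma+1\rangle$. For complex parameters $\varkappa_k,a_k,b_k,c_k,d_k$ put $$L_k(\lambda)=\begin{pmatrix}1+\lambda\varkappa_k v_k&\lambda u_k^{-1}(a_k-b_kv_k)\\ u_k(c_k-d_kv_k)&\lambda a_kc_k+v_kb_kd_k/\varkappa_k\end{pmatrix},\qquad L_1(\lambda)\cdots L_n(\lambda)=\begin{pmatrix}A_n(\lambda)&B_n(\lambda)\\ C_n(\lambda)&D_n(\lambda)\end{pmatrix},$$ $V_n=v_1\cdots v_n$, $F_n(\lambda)=(b_n+\omega a_n\varkappa_n\lambda)(\lambda c_n+d_n/\varkappa_n)$, and $$\mathcal L_k(\lambda^N)=\begin{pmatrix}1-\epsilon\varkappa_k^N\lambda^N&-\epsilon\lambda^N(a_k^N-b_k^N)\\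 c_k^N-d_k^N&b_k^Nd_k^N/\varkappa_k^N-\epsilon\lambda^Na_k^Nc_k^N\end{pmatrix},\quad \mathcal T_m=\mathcal L_1\cdots\mathcal L_m,\quad \mathcal B_m=(\mathcal T_m)_{12}.$$ **Assumptions.** $\varkappa_m,a_m,b_m\ne0$ and $a_m^N\neq b_m^N$ for $1\le m\le n$; $d_m\ne 0$ for $2\le m\le n$; $c_m\neq 0$ for $2\le m\le n-1$. For $2\le m\le n$ all zeros of the polynomial $\mathcal B_m(\lambda^N)/\lambda^N$ in the variable $\lambda^N$ are nonzero and simple, and $\det\mathcal T_n\ne0$ at these zeros. **Choices.** Fix any numbers $r_m$ with $r_m^N=a_m^N-b_m^N$ ($1\le m\le n$), and any $r_{m,s}$ ($1\le m\le n$, $0\le s\le m-1$) with $r_{1,0}=r_1$ and $\mathcal B_m(\lambda^N)=(-\epsilon)^m\lambda^Nr_{m,0}^N\prod_{s=1}^{m-1}(\lambda^N-\epsilon r_{m,s}^N)$; put $\tilde r_m=\prod_{s=0}^{m-1}r_{m,s}$. Let $p_m=(r_m/a_m,\,b_m/a_m)$. For $s,s'\ge1$ choose any $y^{m,s}_{m',s'}$,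 $\tilde y_{m,s}$ (the latter for $m<n$) such that $p^{m,s}_{m',s'}=(r_{m,s}/r_{m',s'},\,y^{m,s}_{m',s'})$ and $\tilde p_{m,s}=(d_m/(\varkappa_mc_mr_{m,s}),\,\tilde y_{m,s})$ lie on the Fermat curve $x^N+y^N=1$. Put $$p_{m,0}=\Big(\frac{r_{m-1,0}a_mc_m}{r_{m,0}},\frac{\varkappa_1\cdots\varkappa_{m-1}r_m}{r_{m,0}}\Big),\qquad \tilde p_m=\Big(\frac{r_m}{\tilde r_m},\frac{b_md_m\tilde r_{m-1}}{\varkappa_m\tilde r_m}\Big)\qquad(2\le m\le n),$$ and $p_{m,l}=(a_m\varkappa_mr_{m,l}/b_m,\,y_{m,l})$ ($1\le l\le m-1$, $m\le n-1$), where $y_{m,l}$ is determined by $$\frac{\tilde r_m\,r_{m+1,0}\,r_m}{\tilde r_{m-1}\,r_{m,0}\,r_{m+1}\,b_mc_m\,y_{m,l}\tilde y_{m,l}}\prod_{\substack{s=1\\ s\ne l}}^{m-1}\frac{y^{m,l}_{m,s}}{y^{m,s}_{m,l}}\cdot\frac{\prod_{k=1}^{m}y^{m+1,k}_{m,l}}{\prod_{s=1}^{m-2}y^{m,l}_{m-1,s}}=1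 .$$ For a point $p=(x,y)$ of the Fermat curve with $y\ne0$ let $w_p$ be the function on $\mathbb Z_N$ with $w_p(0)=1$, $w_p(\gamma)/w_p(\gamma-1)=y/(1-\omega^\gamma x)$. **Vectors.** Let $\psi^{(k)}_\rho=\sum_{\gamma\in\mathbb Z_N}w_{p_k}(\gamma-\rho)|\gamma\rangle\in V_k$. For $\boldsymbol\rho_m=(\rho_{m,0},\dots,\rho_{m,m-1})\in\mathbb Z_N^m$ put $\tilde\rho_m=\sum_s\rho_{m,s}$, let $\boldsymbol\rho_m^{+k}$ be $\boldsymbol\rho_m$ with $\rho_{m,k}$ replaced by $\rho_{m,k}+1$, and define recursively $\Psi_{\rho_{1,0}}=\psi^{(1)}_{\rho_{1,0}}$ and, for $m\ge2$, $$\Psi_{\boldsymbol\rho_m}=\sum_{\boldsymbol\rho_{m-1}\in\mathbb Z_N^{m-1},\ \rho_m\in\mathbb Z_N}Q(\boldsymbol\rho_{m-1},\rho_m|\boldsymbol\rho_m)\,\Psi_{\boldsymbol\rho_{m-1}}\otimes\psi^{(m)}_{\rho_m},$$ $$Q(\boldsymbol\rho_{m-1},\rho_m|\boldsymbol\rho_m)=\frac{\omega^{(\tilde\rho_m-\tilde\rho_{m-1})(\rho_m-\rho_{m,0})}}{w_{p_{m,0}}(\rho_{m,0}-\rho_{m-1,0}-1)\,w_{\tilde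 p_m}(\tilde\rho_m-\rho_m-1)}\cdot\frac{\prod_{l=1}^{m-2}\prod_{k=1}^{m-1}w_{p^{m,k}_{m-1,l}}(\rho_{m-1,l}-\rho_{m,k})}{\prod_{j\ne l}^{m-2}w_{p^{m-1,l}_{m-1,j}}(\rho_{m-1,j}-\rho_{m-1,l})}\prod_{l=1}^{m-2}\frac{w_{p_{m-1,l}}(-\rho_{m-1,l})}{w_{\tilde p_{m-1,l}}(\rho_{m-1,l})}.$$ **Theorem.** All the points used in the construction lie on the Fermat curve and have $y\neq0$. For every $\boldsymbol\rho_n\in\mathbb Z_N^n$ and $\lambda\in\mathbb C$, the vector $\Psi_{\boldsymbol\rho_n}$ is nonzero and $$B_n(\lambda)\Psi_{\boldsymbol\rho_n}=\lambda\,r_{n,0}\omega^{-\rho_{n,0}}\prod_{k=1}^{n-1}\big(\lambda+r_{n,k}\omega^{-\rho_{n,k}}\big)\Psi_{\boldsymbol\rho_n}.$$ With $\lambda_{n,k}=-r_{n,k}\omega^{-\rho_{n,k}}$ and $\varphi_k=-\dfrac{\tilde r_{n-1}}{r_n}\,\omega^{-\tilde\rho_n+\rho_{n,0}}F_n(\lambda_{n,k}/\omega)\prod_{s=1}^{n-2}y^{n,k}_{n-1,s}$,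 $$A_n(\lambda)\Psi_{\boldsymbol\rho_n}=\prod_{s=1}^{n-1}\Big(1-\frac{\lambda}{\lambda_{n,s}}\Big)\Psi_{\boldsymbol\rho_n}+\lambda\varkappa_1\cdots\varkappa_n\prod_{s=1}^{n-1}(\lambda-\lambda_{n,s})\Psi_{\boldsymbol\rho_n^{+0}}+\sum_{k=1}^{n-1}\Big(\prod_{s\ne k}\frac{\lambda-\lambda_{n,s}}{\lambda_{n,k}-\lambda_{n,s}}\Big)\frac{\lambda}{\lambda_{n,k}}\varphi_k\Psi_{\boldsymbol\rho_n^{+k}}.$$ **Corollary.** $A_n(\lambda_{n,k})\Psi_{\boldsymbol\rho_n}=\varphi_k\Psi_{\boldsymbol\rho_n^{+k}}$ for $1\le k\le n-1$, and $V_n\Psi_{\boldsymbol\rho_n}=\Psi_{\boldsymbol\rho_n^{+0}}$. -/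

import Mathlib

open Polynomial

noncomputable section

namespace BBS

/-! ### Phases and the cyclic function on the Fermat curve -/

/-- The phase `ω ^ γ` for `γ ∈ ℤ/N`, where `ω = exp (2πi / N)`. -/
def ph {N : ℕ} [NeZero N] (γ : ZMod N) : ℂ := ZMod.stdAddChar γ

/-- The root of unity `ω = exp (2πi / N)`. -/
def om (N : ℕ) [NeZero N] : ℂ := ph (1 : ZMod N)

theorem om_eq (N : ℕ) [NeZero N] : om N = Complex.exp (2 * Real.pi * Complex.I / N) := by
  have h := ZMod.stdAddChar_coe (N := N) 1
  simpa [om, ph] using h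

theorem ph_eq_pow {N : ℕ} [NeZero N] (γ : ZMod N) : ph γ = om N ^ γ.val := by
  have h := AddChar.map_nsmul_eq_pow (ZMod.stdAddChar (N := N)) γ.val 1
  simpa [om, ph, nsmul_eq_mul] using h

theorem ph_add {N : ℕ} [NeZero N] (γ δ : ZMod N) : ph (γ + δ) = ph γ * ph δ :=
  AddChar.map_add_eq_mul _ _ _

theorem ph_zero {N : ℕ} [NeZero N] : ph (0 : ZMod N) = 1 := AddChar.map_zero_eq_one _

/-- The point `p = (x, y)` lies on the Fermat curve `x ^ N + y ^ N = 1`. -/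
def OnFermat (N : ℕ) (p : ℂ × ℂ) : Prop := p.1 ^ N + p.2 ^ N = 1

/-- A point of the Fermat curve with `y ≠ 0`: exactly the points for which the difference equation
`w (γ) / w (γ - 1) = y / (1 - ω ^ γ x)`, `w (0) = 1` has a well-defined nowhere vanishing
solution on `ℤ/N`. -/
def Regular (N : ℕ) (p : ℂ × ℂ) : Prop := OnFermat N p ∧ p.2 ≠ 0

/-- The cyclic function `w_p (γ) = ∏_{j = 1}^{γ} y / (1 - ω ^ j x)`, for `0 ≤ γ < N`. -/
def w {N : ℕ} [NeZero N] (p : ℂ × ℂ) (γ : ZMod N) : ℂ :=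
  ∏ j ∈ Finset.Icc 1 γ.val, p.2 / (1 - om N ^ j * p.1)

/-! ### The quantum chain -/

/-- The space `V_1 ⊗ ⋯ ⊗ V_n` of the chain with `n` sites, every `V_k` with basis
`|γ⟩`, `γ ∈ ℤ/N`: a vector is given by its coordinates in the basis `|γ_1⟩ ⊗ ⋯ ⊗ |γ_n⟩`. -/
abbrev State (N n : ℕ) : Type := (Fin n → ZMod N) → ℂ

/-- The tensor product of a vector of the first `n` sites and a vector of the last site. -/
def tens {N n : ℕ} (Ψ : State N n) (ψ : ZMod N → ℂ) : State N (n + 1) :=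
  fun γ => Ψ (Fin.init γ) * ψ (γ (Fin.last n))

/-- The Weyl element `u_k`, with `u_k |γ⟩ = ω ^ γ_k |γ⟩`. -/
def uOp {N n : ℕ} [NeZero N] (k : Fin n) : Module.End ℂ (State N n) where
  toFun f := fun γ => ph (γ k) * f γ
  map_add' f g := by funext γ; simp [mul_add]
  map_smul' c f := by funext γ; simp [mul_left_comm]

/-- The inverse of the Weyl element `u_k`. -/
def uInv {N n : ℕ} [NeZero N] (k : Fin n) : Module.End ℂ (State N n) where
  toFun f := fun γ => ph (-(γ k)) * f γ
  map_add' f g := by funext γ; simp [mul_add]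
  map_smul' c f := by funext γ; simp [mul_left_comm]

theorem uOp_mul_uInv {N n : ℕ} [NeZero N] (k : Fin n) :
    uOp (N := N) k * uInv k = 1 := by
  refine LinearMap.ext fun f => funext fun γ => ?_
  simp [uOp, uInv, Module.End.mul_apply, ← mul_assoc, ← ph_add, ph_zero]

theorem uInv_mul_uOp {N n : ℕ} [NeZero N] (k : Fin n) :
    uInv (N := N) k * uOp k = 1 := by
  refine LinearMap.ext fun f => funext fun γ => ?_
  simp [uOp, uInv, Module.End.mul_apply, ← mul_assoc, ← ph_add, ph_zero]

/-- The Weyl element `v_k`, with `v_k |γ⟩ = |γ_1, …, γ_k + 1, …, γ_n⟩`. -/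
def vOp {N n : ℕ} (k : Fin n) : Module.End ℂ (State N n) :=
  LinearMap.funLeft ℂ ℂ (fun γ : Fin n → ZMod N => Function.update γ k (γ k - 1))

theorem vOp_single {N n : ℕ} (k : Fin n) (γ : Fin n → ZMod N) :
    vOp k (Pi.single γ 1 : State N n) = Pi.single (Function.update γ k (γ k + 1)) 1 := by
  funext δ
  simp only [vOp, LinearMap.funLeft_apply, Pi.single_apply]
  congr 1
  apply propext
  constructor
  · rintro rfl; simp
  · rintro rfl; simp

/-- The parameters of the model; the sites are numbered from `1`. -/
structure Params where
  /-- the parameters `ϰ_k` -/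
  kap : ℕ → ℂ
  /-- the parameters `a_k` -/
  a : ℕ → ℂ
  /-- the parameters `b_k` -/
  b : ℕ → ℂ
  /-- the parameters `c_k` -/
  c : ℕ → ℂ
  /-- the parameters `d_k` -/
  d : ℕ → ℂ

/-- The `L`-operator at spectral parameter `z` with the parameters of site `j`, whose Weyl elements
act on the tensor factor `k`. -/
def LOp {N n : ℕ} [NeZero N] (P : Params) (j : ℕ) (k : Fin n) (z : ℂ) :
    Matrix (Fin 2) (Fin 2) (Module.End ℂ (State N n)) :=
  !![1 + (z * P.kap j) • vOp k,
      z • (uInv k * (P.a j • 1 - P.b j • vOp k));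
    uOp k * (P.c j • 1 - P.d j • vOp k),
      (z * P.a j * P.c j) • 1 + (P.b j * P.d j / P.kap j) • vOp k]

/-- The monodromy matrix `T_n (z) = L_1 (z) L_2 (z) ⋯ L_n (z)`. -/
def T {N : ℕ} [NeZero N] (P : Params) (n : ℕ) (z : ℂ) :
    Matrix (Fin 2) (Fin 2) (Module.End ℂ (State N n)) :=
  (List.ofFn fun k : Fin n => LOp P (k + 1) k z).prod

/-- The entry `A_n (z)` of the monodromy matrix. -/
def A {N : ℕ} [NeZero N] (P : Params) (n : ℕ) (z : ℂ) : Module.End ℂ (State N n) := T P n z 0 0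

/-- The entry `B_n (z)` of the monodromy matrix. -/
def B {N : ℕ} [NeZero N] (P : Params) (n : ℕ) (z : ℂ) : Module.End ℂ (State N n) := T P n z 0 1

/-- The charge rotation operator `V_n = v_1 v_2 ⋯ v_n`. -/
def V (N n : ℕ) : Module.End ℂ (State N n) := (List.ofFn fun k : Fin n => vOp k).prod

/-! ### The classical monodromy matrix -/

/-- The sign `ε = (-1) ^ N`. -/
def eps (N : ℕ) : ℂ := (-1) ^ N

/-- The classical `L`-operator of site `j`, the entrywise average `∏_{s ∈ ℤ/N} O (ω ^ s z)` of the
quantum one, as a matrix of polynomials in the variable `X = z ^ N`. -/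
def Lcl (N : ℕ) (P : Params) (j : ℕ) : Matrix (Fin 2) (Fin 2) ℂ[X] :=
  !![1 - C (eps N * P.kap j ^ N) * X, -C (eps N * (P.a j ^ N - P.b j ^ N)) * X;
    C (P.c j ^ N - P.d j ^ N),
      C (P.b j ^ N * P.d j ^ N / P.kap j ^ N) - C (eps N * P.a j ^ N * P.c j ^ N) * X]

/-- The classical monodromy matrix of the first `m` sites. -/
def Tcl (N : ℕ) (P : Params) (m : ℕ) : Matrix (Fin 2) (Fin 2) ℂ[X] :=
  (List.ofFn fun k : Fin m => Lcl N P (k + 1)).prod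

/-- The polynomial `𝓑_m` in `X = z ^ N`. -/
def Bcl (N : ℕ) (P : Params) (m : ℕ) : ℂ[X] := Tcl N P m 0 1

/-! ### Amplitudes and Fermat curve points -/

/-- The quantities that are determined by the parameters only up to roots of unity. -/
structure Choice where
  /-- the one-site amplitudes `r_m` -/
  r1 : ℕ → ℂ
  /-- the amplitudes `r_{m,s}`, `0 ≤ s ≤ m - 1` -/
  r : ℕ → ℕ → ℂ
  /-- `y m s m' s'` is the second coordinate of the point with upper indices `m, s` and lower
  indices `m', s'` -/
  y : ℕ → ℕ → ℕ → ℕ → ℂ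
  /-- `yt m s` is the second coordinate of the point `p̃_{m,s}` -/
  yt : ℕ → ℕ → ℂ

/-- The product `r̃_m = r_{m,0} r_{m,1} ⋯ r_{m,m-1}`. -/
def rtil (S : Choice) (m : ℕ) : ℂ := ∏ s ∈ Finset.range m, S.r m s

/-- The point `p_k = (r_k / a_k, b_k / a_k)`. -/
def pSite (P : Params) (S : Choice) (k : ℕ) : ℂ × ℂ := (S.r1 k / P.a k, P.b k / P.a k)

/-- The point with upper indices `m, s`, lower indices `m', s'` and `x = r_{m,s} / r_{m',s'}`. -/
def pPair (S : Choice) (m s m' s' : ℕ) : ℂ × ℂ := (S.r m s / S.r m' s', S.y m s m' s')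

/-- The point `p̃_{m,s}`, with `x̃_{m,s} = d_m / (ϰ_m c_m r_{m,s})`. -/
def pTilPair (P : Params) (S : Choice) (m s : ℕ) : ℂ × ℂ :=
  (P.d m / (P.kap m * P.c m * S.r m s), S.yt m s)

/-- The coordinate `y_{m,l}`, `1 ≤ l ≤ m - 1`: the solution of
`r̃_m r_{m+1,0} r_m / (r̃_{m-1} r_{m,0} r_{m+1} b_m c_m y_{m,l} ỹ_{m,l})
  * ∏_{s ≠ l} (y^{m,l}_{m,s} / y^{m,s}_{m,l})
  * (∏_{k=1}^{m} y^{m+1,k}_{m,l}) / (∏_{s=1}^{m-2} y^{m,l}_{m-1,s}) = 1`. -/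
def yPt (P : Params) (S : Choice) (m l : ℕ) : ℂ :=
  rtil S m * S.r (m + 1) 0 * S.r1 m /
      (rtil S (m - 1) * S.r m 0 * S.r1 (m + 1) * P.b m * P.c m * S.yt m l)
    * (∏ s ∈ (Finset.Icc 1 (m - 1)).erase l, S.y m l m s / S.y m s m l)
    * ((∏ k ∈ Finset.Icc 1 m, S.y (m + 1) k m l) /
        ∏ s ∈ Finset.Icc 1 (m - 2), S.y m l (m - 1) s)

/-- The point `p_{m,l}`, `1 ≤ l ≤ m - 1`, with `x_{m,l} = a_m ϰ_m r_{m,l} / b_m`. -/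
def pPt (P : Params) (S : Choice) (m l : ℕ) : ℂ × ℂ :=
  (P.a m * P.kap m * S.r m l / P.b m, yPt P S m l)

/-- The point `p_{m,0}`, with `x_{m,0} r_{m,0} = r_{m-1,0} a_m c_m` and
`y_{m,0} r_{m,0} = ϰ_1 ⋯ ϰ_{m-1} r_m`. -/
def pZero (P : Params) (S : Choice) (m : ℕ) : ℂ × ℂ :=
  (S.r (m - 1) 0 * P.a m * P.c m / S.r m 0,
    (∏ j ∈ Finset.Icc 1 (m - 1), P.kap j) * S.r1 m / S.r m 0)

/-- The point `p̃_m`, with `x̃_m r̃_m = r_m` and `ỹ_m r̃_m = b_m d_m r̃_{m-1} / ϰ_m`. -/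
def pTil (P : Params) (S : Choice) (m : ℕ) : ℂ × ℂ :=
  (S.r1 m / rtil S m, P.b m * P.d m * rtil S (m - 1) / P.kap m / rtil S m)

/-- The genericity assumptions on the parameters of the chain with `n` sites. The non-vanishing
of the individual parameters says that every coordinate of a Fermat curve point which is given as
a quotient has a nonzero denominator, and that none of the points degenerates. -/
structure Generic (N : ℕ) (P : Params) (n : ℕ) : Prop where
  kap_ne : ∀ m, 1 ≤ m → m ≤ n → P.kap m ≠ 0
  a_ne : ∀ m, 1 ≤ m → m ≤ n → P.a m ≠ 0
  b_ne : ∀ m, 1 ≤ m → m ≤ n → P.b m ≠ 0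
  d_ne : ∀ m, 2 ≤ m → m ≤ n → P.d m ≠ 0
  c_ne : ∀ m, 2 ≤ m → m < n → P.c m ≠ 0
  /-- `r_m ^ N ≠ 0` -/
  r_ne : ∀ m, 1 ≤ m → m ≤ n → P.a m ^ N - P.b m ^ N ≠ 0
  /-- the polynomials `𝓑_m / X` have nonzero simple zeros -/
  simple : ∀ m, 2 ≤ m → m ≤ n → ∀ t : ℂ, (Bcl N P m).divX.IsRoot t →
    t ≠ 0 ∧ (Bcl N P m).divX.rootMultiplicity t = 1
  /-- `det 𝓣_n` does not vanish at the zeros of the polynomials `𝓑_m / X` -/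
  det_ne : ∀ m, 2 ≤ m → m ≤ n → ∀ t : ℂ, (Bcl N P m).divX.IsRoot t →
    (Tcl N P n).det.eval t ≠ 0

/-- The equations that fix the amplitudes and the coordinates `y` up to roots of unity. -/
structure IsChoice (N : ℕ) (P : Params) (S : Choice) (n : ℕ) : Prop where
  r1_pow : ∀ m, 1 ≤ m → m ≤ n → S.r1 m ^ N = P.a m ^ N - P.b m ^ N
  r_one : S.r 1 0 = S.r1 1
  /-- `𝓑_m = (-ε) ^ m X r_{m,0} ^ N ∏_{s=1}^{m-1} (X - ε r_{m,s} ^ N)` -/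
  r_pow : ∀ m, 1 ≤ m → m ≤ n →
    Bcl N P m = C ((-eps N) ^ m * S.r m 0 ^ N) * X *
      ∏ s ∈ Finset.Icc 1 (m - 1), (X - C (eps N * S.r m s ^ N))
  y_pow : ∀ m s m' s', 1 ≤ s → s < m → m ≤ n → 1 ≤ s' → s' < m' → m' ≤ n →
    OnFermat N (pPair S m s m' s')
  yt_pow : ∀ m s, 1 ≤ s → s < m → m < n → OnFermat N (pTilPair P S m s)

/-! ### The vectors `Ψ` -/

/-- The one-site vectors `ψ^{(k)}_ρ = ∑_γ w_{p_k} (γ - ρ) |γ⟩`. -/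
def psi {N : ℕ} [NeZero N] (P : Params) (S : Choice) (k : ℕ) (ρ : ZMod N) : ZMod N → ℂ :=
  fun γ => w (pSite P S k) (γ - ρ)

/-- The coefficient `Q (ρ_{n-1}, ρ_n | ρ_n)` of the step from `n - 1 = m + 1` to `n = m + 2` sites.
Here `σ` stands for `ρ_{n-1}`, `q` for the one-site label `ρ_n`, and `ρ` for the
`n`-component label. -/
def Q {N : ℕ} [NeZero N] (P : Params) (S : Choice) (m : ℕ)
    (σ : Fin (m + 1) → ZMod N) (q : ZMod N) (ρ : Fin (m + 2) → ZMod N) : ℂ :=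
  ph ((∑ i, ρ i - ∑ i, σ i) * (q - ρ 0)) /
      (w (pZero P S (m + 2)) (ρ 0 - σ 0 - 1) * w (pTil P S (m + 2)) (∑ i, ρ i - q - 1))
    * ((∏ l : Fin m, ∏ k : Fin (m + 1),
          w (pPair S (m + 2) (k + 1) (m + 1) (l + 1)) (σ l.succ - ρ k.succ)) /
        ∏ j : Fin m, ∏ l ∈ Finset.univ.erase j,
          w (pPair S (m + 1) (l + 1) (m + 1) (j + 1)) (σ j.succ - σ l.succ))
    * ∏ l : Fin m, w (pPt P S (m + 1) (l + 1)) (-σ l.succ) /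
        w (pTilPair P S (m + 1) (l + 1)) (σ l.succ)

/-- The vectors `Ψ_ρ` of the chain with `m + 1` sites, `ρ = (ρ_0, …, ρ_m)`. -/
def Psi {N : ℕ} [NeZero N] (P : Params) (S : Choice) :
    (m : ℕ) → (Fin (m + 1) → ZMod N) → State N (m + 1)
  | 0, ρ => fun γ => psi P S 1 (ρ 0) (γ 0)
  | m + 1, ρ => ∑ σ : Fin (m + 1) → ZMod N, ∑ q : ZMod N,
      Q P S m σ q ρ • tens (Psi P S m σ) (psi P S (m + 2) q)

/-- The label `ρ ^ {+k}`, in which `ρ_k` is replaced by `ρ_k + 1`. -/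
def raise {N n : ℕ} (ρ : Fin n → ZMod N) (k : Fin n) : Fin n → ZMod N :=
  Function.update ρ k (ρ k + 1)

/-- The zero `λ_{n,k} = - r_{n,k} ω ^ {-ρ_{n,k}}`. -/
def lam {N n : ℕ} [NeZero N] (S : Choice) (ρ : Fin n → ZMod N) (k : Fin n) : ℂ :=
  -(S.r n k * ph (-ρ k))

/-- The function `F_n (z) = (b_n + ω a_n ϰ_n z) (z c_n + d_n / ϰ_n)`. -/
def F (N : ℕ) [NeZero N] (P : Params) (n : ℕ) (z : ℂ) : ℂ :=
  (P.b n + om N * P.a n * P.kap n * z) * (z * P.c n + P.d n / P.kap n)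

/-- The factor `φ_k` of the chain with `n = m + 1` sites. -/
def phi {N m : ℕ} [NeZero N] (P : Params) (S : Choice) (ρ : Fin (m + 1) → ZMod N)
    (k : Fin (m + 1)) : ℂ :=
  -(rtil S m / S.r1 (m + 1)) * ph (-(∑ i, ρ i) + ρ 0) * F N P (m + 1) (lam S ρ k / om N) *
    ∏ s ∈ Finset.Icc 1 (m - 1), S.y (m + 1) k m s

/-! ### The cyclic function solves its difference equation -/

theorem om_pow (N : ℕ) [NeZero N] : om N ^ N = 1 := by
  have h := AddChar.map_nsmul_eq_pow (ZMod.stdAddChar (N := N)) N 1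
  simpa [om, ph, nsmul_eq_mul] using h.symm

theorem w_zero {N : ℕ} [NeZero N] (p : ℂ × ℂ) : w p (0 : ZMod N) = 1 := by simp [w]

theorem one_sub_ne {N : ℕ} [NeZero N] {p : ℂ × ℂ} (hp : Regular N p) (j : ℕ) :
    1 - om N ^ j * p.1 ≠ 0 := by
  intro h
  have h1 : om N ^ j * p.1 = 1 := (sub_eq_zero.mp h).symm
  have h2 : p.1 ^ N = 1 := by
    have := congrArg (· ^ N) h1
    have h4 : (om N ^ j) ^ N = 1 := by rw [← pow_mul, mul_comm, pow_mul, om_pow, one_pow]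
    simpa [mul_pow, h4] using this
  have h3 := hp.1
  simp [OnFermat, h2] at h3
  exact hp.2 h3.1

theorem w_ne_zero {N : ℕ} [NeZero N] {p : ℂ × ℂ} (hp : Regular N p) (γ : ZMod N) :
    w p γ ≠ 0 :=
  Finset.prod_ne_zero_iff.mpr fun j _ => div_ne_zero hp.2 (one_sub_ne hp j)

theorem prod_one_sub {N : ℕ} [NeZero N] (x : ℂ) :
    ∏ j ∈ Finset.Icc 1 N, (1 - om N ^ j * x) = 1 - x ^ N := by
  have hpos : 0 < N := Nat.pos_of_ne_zero (NeZero.ne N)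
  have hprim : IsPrimitiveRoot (om N) N := by
    rw [om_eq]; exact Complex.isPrimitiveRoot_exp N (NeZero.ne N)
  have h := hprim.pow_sub_pow_eq_prod_sub_mul 1 x hpos
  rw [one_pow] at h
  rw [h]
  have h1 : ∏ j ∈ Finset.Icc 1 N, (1 - om N ^ j * x) =
      ∏ j ∈ Finset.range N, (1 - om N ^ j * x) := by
    have key : ∀ (M : ℕ) (z : ℂ), z ^ (M + 1) = 1 →
        ∏ j ∈ Finset.Icc 1 (M + 1), (1 - z ^ j * x) =
          ∏ j ∈ Finset.range (M + 1), (1 - z ^ j * x) := by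
      intro M z hz
      have e : Finset.Icc 1 (M + 1) = Finset.Ico 1 (M + 1 + 1) := by ext j; simp
      rw [e, Finset.prod_Ico_eq_prod_range, Nat.add_sub_cancel, Finset.prod_range_succ,
        Finset.prod_range_succ', add_comm 1 M, hz, pow_zero]
      congr 1
      exact Finset.prod_congr rfl fun k _ => by rw [add_comm]
    have hN : N - 1 + 1 = N := by omega
    have h2 := key (N - 1) (om N) (by rw [hN]; exact om_pow N)
    rwa [hN] at h2
  rw [h1]
  refine Finset.prod_bij (fun j _ => om N ^ j) ?_ ?_ ?_ ?_
  · intro j _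
    rw [Polynomial.mem_nthRootsFinset hpos]
    rw [← pow_mul, mul_comm, pow_mul, om_pow, one_pow]
  · intro i hi j hj hij
    exact hprim.pow_inj (Finset.mem_range.mp hi) (Finset.mem_range.mp hj) hij
  · intro ζ hζ
    rw [Polynomial.mem_nthRootsFinset hpos] at hζ
    obtain ⟨i, hi, rfl⟩ := hprim.eq_pow_of_pow_eq_one hζ
    exact ⟨i, Finset.mem_range.mpr hi, rfl⟩
  · intro j _; rfl

/-- The difference equation of the cyclic function. -/
theorem w_rec {N : ℕ} [NeZero N] {p : ℂ × ℂ} (hp : Regular N p) (γ : ZMod N) :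
    w p γ / w p (γ - 1) = p.2 / (1 - ph γ * p.1) := by
  obtain ⟨M, rfl⟩ : ∃ M, N = M + 1 := ⟨N - 1, by have := NeZero.ne N; omega⟩
  by_cases hγ : γ = 0
  · subst hγ
    have hv : ((0 : ZMod (M + 1)) - 1).val = M := by rw [zero_sub]; exact ZMod.val_neg_one M
    have hall : ∏ j ∈ Finset.Icc 1 (M + 1), p.2 / (1 - om (M + 1) ^ j * p.1) = 1 := by
      rw [Finset.prod_div_distrib, prod_one_sub, Finset.prod_const, Nat.card_Icc]
      have h := hp.1
      have hy : p.2 ^ (M + 1) ≠ 0 := pow_ne_zero _ hp.2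
      rw [OnFermat] at h
      have h2 : 1 - p.1 ^ (M + 1) = p.2 ^ (M + 1) := by linear_combination -h
      rw [h2, Nat.add_sub_cancel]
      exact div_self hy
    rw [Finset.prod_Icc_succ_top (by omega), om_pow, one_mul] at hall
    have hw : w p ((0 : ZMod (M + 1)) - 1) * (p.2 / (1 - p.1)) = 1 := by
      rw [w, hv]; exact hall
    rw [w_zero, ph_zero, one_mul, div_eq_iff (w_ne_zero hp _), mul_comm, hw]
  · have hpos : 0 < γ.val := Nat.pos_of_ne_zero fun h => hγ ((ZMod.val_eq_zero γ).mp h)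
    have hlt := ZMod.val_lt γ
    have h1 : (1 : ZMod (M + 1)).val ≤ γ.val := by
      rw [ZMod.val_one_eq_one_mod]
      exact (Nat.mod_le _ _).trans hpos
    have hv : γ.val = (γ - 1).val + 1 := by
      rw [ZMod.val_sub h1, ZMod.val_one_eq_one_mod, Nat.mod_eq_of_lt (by omega)]
      omega
    have hw : w p γ = w p (γ - 1) * (p.2 / (1 - ph γ * p.1)) := by
      rw [ph_eq_pow, w, w, hv, Finset.prod_Icc_succ_top (by omega)]
    rw [hw, mul_div_cancel_left₀ _ (w_ne_zero hp _)]

end BBS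

end

noncomputable section

namespace BBS

/-! ### The classical monodromy matrix and its zeros -/

/-! The proof is an induction on the length of the chain, run for `A` and `B` together. Splitting
off the last site writes the new `A` and `B` through the old ones and the Weyl elements of that
site. The vectors `psi` diagonalize `u⁻¹ (a - b v)` there, and `v` raises their label. Since the old
`A` and `B` act explicitly on `Psi P S m σ`, everything reduces to scalar polynomial identities in
`z` for the coefficient of each `Ψ_σ ⊗ ψ_q`.

For `B`, divide the coefficient identity by `z`. Both sides then have degree at most `m + 1`, so
they are determined by the constant term, the leading coefficient and the values at the `m` zeros of
the old eigenvalue (`eq_interp`). These data are difference equations for `Q`: in `q` for `p̃_m`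
(`Q_const_coeff`), in `σ 0` for `p_{m,0}` (`Q_top_coeff`), and in the other `σ l` for the remaining
points (`Q_node_coeff`). They combine to `coefA_beta_identity`.

For `A`, the same interpolation is made at the zeros of the new eigenvalue. There the vanishing of
that eigenvalue expresses the old `A` through the old `B`, and only one term, with the factor `F`,
remains (`coefA_node`, `Q_raise_phi`). The leading coefficient comes from the invariance
`Q_raise_zero`.

The functions `w` exist because the points lie on the Fermat curve with `y ≠ 0`. The lowest and
highest coefficients of the classical recursion give `p̃_m` and `p_{m,0}`. The points `p_{m,l}`,
whose `y` is prescribed, need the three-term relation for `𝓑` (`yPt_pow`). Simple zeros and the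
nonvanishing determinant exclude `y = 0`.

Finally `Ψ ≠ 0` because no `Q` vanishes and the products `Ψ_σ ⊗ ψ_q` are linearly independent:
eigenvectors with distinct eigenvalues in each factor. -/

theorem eps_mul_self (N : ℕ) : eps N * eps N = 1 := by
  rw [eps, ← mul_pow]; simp

theorem eps_ne_zero (N : ℕ) : eps N ≠ 0 := fun h => by
  have := eps_mul_self N
  simp [h] at this

theorem Tcl_succ (N : ℕ) (P : Params) (m : ℕ) :
    Tcl N P (m + 1) = Tcl N P m * Lcl N P (m + 1) := by
  rw [Tcl, Tcl, List.ofFn_succ', List.concat_eq_append, List.prod_append, List.prod_singleton]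
  rfl

theorem Tcl_zero (N : ℕ) (P : Params) : Tcl N P 0 = 1 := by simp [Tcl]

theorem Acl_succ (N : ℕ) (P : Params) (m : ℕ) :
    Tcl N P (m + 1) 0 0 = Tcl N P m 0 0 * (1 - C (eps N * P.kap (m + 1) ^ N) * X) +
      Bcl N P m * C (P.c (m + 1) ^ N - P.d (m + 1) ^ N) := by
  simp [Tcl_succ, Matrix.mul_apply, Fin.sum_univ_two, Lcl, Bcl]

theorem Bcl_succ (N : ℕ) (P : Params) (m : ℕ) :
    Bcl N P (m + 1) =
      Tcl N P m 0 0 * (-C (eps N * (P.a (m + 1) ^ N - P.b (m + 1) ^ N)) * X) +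
      Bcl N P m * (C (P.b (m + 1) ^ N * P.d (m + 1) ^ N / P.kap (m + 1) ^ N) -
        C (eps N * P.a (m + 1) ^ N * P.c (m + 1) ^ N) * X) := by
  simp [Tcl_succ, Matrix.mul_apply, Fin.sum_univ_two, Lcl, Bcl]

/-- Carries the assumption on `det 𝓣_n` over to all shorter chains; `det_Lcl_dvd` does the same for
single sites. -/
theorem det_Tcl_dvd (N : ℕ) (P : Params) {m n : ℕ} (h : m ≤ n) :
    (Tcl N P m).det ∣ (Tcl N P n).det := by
  induction n, h using Nat.le_induction with
  | base => exact dvd_rfl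
  | succ n _ ih => rw [Tcl_succ, Matrix.det_mul]; exact ih.mul_right _

theorem det_Lcl_dvd (N : ℕ) (P : Params) {m n : ℕ} (h : m + 1 ≤ n) :
    (Lcl N P (m + 1)).det ∣ (Tcl N P n).det :=
  (Dvd.intro_left _ (by rw [Tcl_succ, Matrix.det_mul])).trans (det_Tcl_dvd N P h)

/-- For `R = r_{m,l} ^ N` the two factors vanish exactly when the `x`-coordinate of `p_{m,l}`,
respectively of `p̃_{m,l}`, is an `N`-th root of unity (where those coordinates have nonzero
denominators). -/
theorem det_Lcl_eval (N : ℕ) (P : Params) (m : ℕ) (hk : P.kap m ≠ 0) (R : ℂ) :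
    (Lcl N P m).det.eval (eps N * R) =
      (P.b m ^ N - P.a m ^ N * P.kap m ^ N * R) * (P.d m ^ N / P.kap m ^ N - P.c m ^ N * R) := by
  have e := eps_mul_self N
  have hk' : P.kap m ^ N ≠ 0 := pow_ne_zero _ hk
  simp only [Lcl, Matrix.det_fin_two_of, eval_sub, eval_mul, eval_neg, eval_C, eval_X,
    eval_one]
  field_simp
  generalize P.kap m ^ N = k at *
  generalize P.a m ^ N = a at *
  generalize P.b m ^ N = b at *
  generalize P.c m ^ N = c at *
  generalize P.d m ^ N = d at *
  generalize eps N = ε at *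
  have e2 : ε ^ 2 = 1 := by rw [sq, e]
  have e4 : ε ^ 4 = 1 := by rw [show (4 : ℕ) = 2 * 2 from rfl, pow_mul, e2, one_pow]
  ring_nf
  simp only [e2, e4]
  ring

theorem eval_Tcl_det (N : ℕ) (P : Params) (m : ℕ) (t : ℂ) : (Tcl N P m).det.eval t =
    (Tcl N P m 0 0).eval t * (Tcl N P m 1 1).eval t -
      (Bcl N P m).eval t * (Tcl N P m 1 0).eval t := by
  simp [Matrix.det_fin_two, Bcl]

theorem Bcl_coeff_zero (N : ℕ) (P : Params) (m : ℕ) : (Bcl N P m).coeff 0 = 0 := by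
  induction m with
  | zero => simp [Bcl, Tcl_zero]
  | succ m ih => rw [Bcl_succ]; simp [ih, mul_coeff_zero]

theorem Acl_coeff_zero (N : ℕ) (P : Params) (m : ℕ) : (Tcl N P m 0 0).coeff 0 = 1 := by
  induction m with
  | zero => simp [Tcl_zero]
  | succ m ih => rw [Acl_succ]; simp [ih, mul_coeff_zero, Bcl_coeff_zero]

theorem coeff_mul_linear (p : ℂ[X]) (u v : ℂ) (k : ℕ) :
    (p * (C u - C v * X)).coeff (k + 1) = p.coeff (k + 1) * u - p.coeff k * v := by
  rw [mul_sub, coeff_sub, coeff_mul_C, mul_comm (C v), ← mul_assoc, coeff_mul_C, coeff_mul_X]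

theorem Tcl_row_degree (N : ℕ) (P : Params) (m : ℕ) :
    (Tcl N P m 0 0).natDegree ≤ m ∧ (Bcl N P m).natDegree ≤ m := by
  have lin : ∀ u v : ℂ, (C u - C v * X).natDegree ≤ 1 := fun u v => by
    compute_degree
  induction m with
  | zero => simp [Bcl, Tcl_zero]
  | succ m ih =>
    constructor
    · rw [Acl_succ]
      refine (natDegree_add_le _ _).trans (max_le ?_ ?_)
      · refine natDegree_mul_le.trans (add_le_add ih.1 ?_)
        simpa using lin 1 (eps N * P.kap (m + 1) ^ N)
      · refine natDegree_mul_le.trans ?_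
        rw [natDegree_C]; omega
    · rw [Bcl_succ]
      refine (natDegree_add_le _ _).trans (max_le ?_ ?_)
      · refine natDegree_mul_le.trans (add_le_add ih.1 ?_)
        simpa using lin 0 (eps N * (P.a (m + 1) ^ N - P.b (m + 1) ^ N))
      · exact natDegree_mul_le.trans (add_le_add ih.2 (lin _ _))

theorem Acl_coeff_top (N : ℕ) (P : Params) (m : ℕ) :
    (Tcl N P m 0 0).coeff m = (-eps N) ^ m * (∏ j ∈ Finset.Icc 1 m, P.kap j) ^ N := by
  induction m with
  | zero => simp [Tcl_zero]
  | succ m ih =>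
    have h1 : (Tcl N P m 0 0).coeff (m + 1) = 0 :=
      coeff_eq_zero_of_natDegree_lt (Nat.lt_succ_of_le (Tcl_row_degree N P m).1)
    have h2 : (Bcl N P m).coeff (m + 1) = 0 :=
      coeff_eq_zero_of_natDegree_lt (Nat.lt_succ_of_le (Tcl_row_degree N P m).2)
    have h3 := coeff_mul_linear (Tcl N P m 0 0) 1 (eps N * P.kap (m + 1) ^ N) m
    rw [C_1] at h3
    rw [Acl_succ, coeff_add, h3, coeff_mul_C, h1, h2, ih, Finset.prod_Icc_succ_top (by omega),
      mul_pow]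
    ring

/-- The extreme cases `k = 0` and `k = m` turn into the Fermat equations of `p̃_{m+1}` and
`p_{m+1,0}`. -/
theorem Bcl_succ_coeff (N : ℕ) (P : Params) (m k : ℕ) :
    (Bcl N P (m + 1)).coeff (k + 1) =
      -(Tcl N P m 0 0).coeff k * (eps N * (P.a (m + 1) ^ N - P.b (m + 1) ^ N)) +
      (Bcl N P m).coeff (k + 1) * (P.b (m + 1) ^ N * P.d (m + 1) ^ N / P.kap (m + 1) ^ N) -
      (Bcl N P m).coeff k * (eps N * P.a (m + 1) ^ N * P.c (m + 1) ^ N) := by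
  have h := coeff_mul_linear (Tcl N P m 0 0) 0 (eps N * (P.a (m + 1) ^ N - P.b (m + 1) ^ N)) k
  rw [C_0, zero_sub, ← neg_mul] at h
  rw [Bcl_succ, coeff_add, coeff_mul_linear, h]
  ring

/-! ### Amplitudes as coefficients and zeros of `𝓑_m` -/

section Zeros

variable {N : ℕ} {P : Params} {S : Choice} {n : ℕ}

/-- With the argument `ε R`, the relation `ε ^ 2 = 1` removes `ε` from the factors and leaves only a
sign. -/
theorem IsChoice.eval_Bcl (hS : IsChoice N P S n) {m : ℕ} (h1 : m + 1 ≤ n) (R : ℂ) :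
    (Bcl N P (m + 1)).eval (eps N * R) =
      (-1) ^ (m + 1) * S.r (m + 1) 0 ^ N * R * ∏ s ∈ Finset.Icc 1 m, (R - S.r (m + 1) s ^ N) := by
  have e : eps N ^ 2 = 1 := by rw [sq, eps_mul_self]
  rw [hS.r_pow _ (by omega) h1, Nat.add_sub_cancel]
  simp only [eval_mul, eval_C, eval_X, eval_prod, eval_sub, ← mul_sub]
  rw [Finset.prod_mul_distrib, Finset.prod_const, Nat.card_Icc, Nat.add_sub_cancel]
  have : (-eps N) ^ (m + 1) * eps N ^ (m + 1) = (-1) ^ (m + 1) := by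
    rw [← mul_pow, neg_mul, eps_mul_self]
  rw [← this]
  ring

theorem IsChoice.coeff_one_Bcl (hS : IsChoice N P S n) {m : ℕ} (h1 : m + 1 ≤ n) :
    (Bcl N P (m + 1)).coeff 1 = -eps N * rtil S (m + 1) ^ N := by
  rw [hS.r_pow _ (by omega) h1, Nat.add_sub_cancel, mul_assoc, coeff_C_mul, coeff_X_mul,
    coeff_zero_eq_eval_zero, eval_prod]
  simp only [eval_sub, eval_X, eval_C, zero_sub, ← neg_mul]
  rw [Finset.prod_mul_distrib, Finset.prod_const, Nat.card_Icc, Nat.add_sub_cancel, rtil,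
    Finset.prod_range_succ', mul_pow, Finset.range_eq_Ico, Finset.prod_Ico_add' (S.r (m + 1)) 0 m 1]
  have h : Finset.Ico (0 + 1) (m + 1) = Finset.Icc 1 m := by ext; simp
  have e : (-eps N) ^ (m + 1) * (-eps N) ^ m = -eps N := by
    have : -eps N * -eps N = 1 := by rw [neg_mul_neg, eps_mul_self]
    rw [pow_succ', mul_assoc, ← mul_pow, this, one_pow, mul_one]
  rw [h, ← Finset.prod_pow]
  linear_combination (S.r (m + 1) 0 ^ N * ∏ i ∈ Finset.Icc 1 m, S.r (m + 1) i ^ N) * e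

theorem IsChoice.coeff_top_Bcl (hS : IsChoice N P S n) {m : ℕ} (h1 : m + 1 ≤ n) :
    (Bcl N P (m + 1)).coeff (m + 1) = (-eps N) ^ (m + 1) * S.r (m + 1) 0 ^ N := by
  rw [hS.r_pow _ (by omega) h1, Nat.add_sub_cancel, mul_assoc, coeff_C_mul, coeff_X_mul]
  have hm : (∏ s ∈ Finset.Icc 1 m, (X - C (eps N * S.r (m + 1) s ^ N))).Monic :=
    monic_prod_of_monic _ _ fun _ _ => monic_X_sub_C _
  have hd : (∏ s ∈ Finset.Icc 1 m, (X - C (eps N * S.r (m + 1) s ^ N))).natDegree = m := by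
    rw [natDegree_prod_of_monic _ _ fun _ _ => monic_X_sub_C _]
    simp only [natDegree_X_sub_C]; simp
  have := hm.coeff_natDegree
  rw [hd] at this
  rw [this, mul_one]

theorem IsChoice.divX_Bcl (hS : IsChoice N P S n) {m : ℕ} (h1 : 1 ≤ m) (h2 : m ≤ n) :
    (Bcl N P m).divX = C ((-eps N) ^ m * S.r m 0 ^ N) *
      ∏ s ∈ Finset.Icc 1 (m - 1), (X - C (eps N * S.r m s ^ N)) := by
  refine ext fun i => ?_
  rw [coeff_divX, hS.r_pow m h1 h2, mul_right_comm, coeff_mul_X]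

theorem IsChoice.isRoot (hS : IsChoice N P S n) {m s : ℕ} (hs : 1 ≤ s) (hsm : s < m) (h2 : m ≤ n) :
    (Bcl N P m).divX.IsRoot (eps N * S.r m s ^ N) := by
  rw [hS.divX_Bcl (by omega) h2, IsRoot, eval_mul, eval_prod,
    Finset.prod_eq_zero (i := s) (by simp; omega) (by simp), mul_zero]

theorem IsChoice.eval_Bcl_eq_zero (hS : IsChoice N P S n) {m s : ℕ} (hs : 1 ≤ s) (hsm : s < m)
    (h2 : m ≤ n) : (Bcl N P m).eval (eps N * S.r m s ^ N) = 0 := by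
  have := hS.isRoot hs hsm h2
  rw [← divX_mul_X_add (Bcl N P m), Bcl_coeff_zero, eval_add, eval_mul, this.eq_zero]
  simp

/-- The three-term relation for `𝓑` at a zero of the middle polynomial. -/
theorem IsChoice.eval_Bcl_three_term (hS : IsChoice N P S n) {m l : ℕ} (hl : 1 ≤ l)
    (hlm : l < m + 1) (h2 : m + 2 ≤ n) :
    (Bcl N P (m + 2)).eval (eps N * S.r (m + 1) l ^ N) * S.r1 (m + 1) ^ N =
      -((Lcl N P (m + 1)).det.eval (eps N * S.r (m + 1) l ^ N)) * S.r1 (m + 2) ^ N *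
        (Bcl N P m).eval (eps N * S.r (m + 1) l ^ N) := by
  have h4 := hS.eval_Bcl_eq_zero hl hlm (by omega)
  have hd : (Lcl N P (m + 1)).det.eval (eps N * S.r (m + 1) l ^ N) =
      (Lcl N P (m + 1) 0 0).eval (eps N * S.r (m + 1) l ^ N) *
        (Lcl N P (m + 1) 1 1).eval (eps N * S.r (m + 1) l ^ N) -
      (Lcl N P (m + 1) 0 1).eval (eps N * S.r (m + 1) l ^ N) *
        (Lcl N P (m + 1) 1 0).eval (eps N * S.r (m + 1) l ^ N) := by
    simp [Matrix.det_fin_two]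
  rw [hd, Bcl_succ N P (m + 1), eval_add, eval_mul, eval_mul (p := Bcl N P (m + 1)), h4, Acl_succ,
    hS.r1_pow _ (by omega) h2,
    hS.r1_pow (m + 1) (by omega) (by omega)]
  -- At a zero of `𝓑_{m+1}` this ties `𝓐_m` to `𝓑_m`; eliminating `𝓐_m` produces the determinant of
  -- `𝓛_{m+1}`.
  rw [Bcl_succ] at h4
  simp only [eval_sub, eval_mul, eval_add, eval_neg, eval_C, eval_X, eval_one, Lcl,
    Matrix.of_apply, Matrix.cons_val_zero, Matrix.cons_val_one, Matrix.cons_val_fin_one] at h4 ⊢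
  linear_combination (1 - eps N * P.kap (m + 1) ^ N * (eps N * S.r (m + 1) l ^ N)) *
    (P.a (m + 2) ^ N - P.b (m + 2) ^ N) * h4

theorem Generic.regular_pSite (hP : Generic N P n) (hS : IsChoice N P S n) {m : ℕ} (h1 : 1 ≤ m)
    (h2 : m ≤ n) : Regular N (pSite P S m) := by
  have ha := hP.a_ne m h1 h2
  refine ⟨?_, div_ne_zero (hP.b_ne m h1 h2) ha⟩
  have ha' : P.a m ^ N ≠ 0 := pow_ne_zero _ ha
  simp only [OnFermat, pSite, div_pow]
  rw [hS.r1_pow m h1 h2]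
  field_simp
  ring

variable [NeZero N]

theorem Generic.r1_ne (hP : Generic N P n) (hS : IsChoice N P S n) {m : ℕ} (h1 : 1 ≤ m)
    (h2 : m ≤ n) : S.r1 m ≠ 0 := fun h => by
  have := hP.r_ne m h1 h2
  rw [← hS.r1_pow m h1 h2, h] at this
  exact this (zero_pow (NeZero.ne N))

/-- Otherwise `𝓑_m / X` would be the zero polynomial and have the forbidden root `0`. For `m = 1`,
where simplicity is not assumed, `r_{1,0} = r_1` is used. -/
theorem Generic.r_zero_ne (hP : Generic N P n) (hS : IsChoice N P S n) {m : ℕ} (h1 : 1 ≤ m)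
    (h2 : m ≤ n) : S.r m 0 ≠ 0 := fun h => by
  rcases h1.eq_or_lt with rfl | h3
  · rw [hS.r_one] at h
    exact hP.r1_ne hS le_rfl h2 h
  · have := (hP.simple m h3 h2 0 (by
      rw [hS.divX_Bcl h1 h2, h, zero_pow (NeZero.ne N)]; simp)).1
    exact this rfl

theorem Generic.r_ne_zero (hP : Generic N P n) (hS : IsChoice N P S n) {m s : ℕ}
    (hsm : s < m) (h2 : m ≤ n) : S.r m s ≠ 0 := fun h => by
  rcases Nat.eq_zero_or_pos s with rfl | hs
  · exact hP.r_zero_ne hS (by omega) h2 h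
  · have := (hP.simple m (by omega) h2 _ (hS.isRoot hs hsm h2)).1
    rw [h, zero_pow (NeZero.ne N), mul_zero] at this
    exact this rfl

theorem Generic.rtil_ne (hP : Generic N P n) (hS : IsChoice N P S n) {m : ℕ} (h2 : m ≤ n) :
    rtil S m ≠ 0 :=
  Finset.prod_ne_zero_iff.mpr fun _ hs => hP.r_ne_zero hS (Finset.mem_range.mp hs) h2

omit [NeZero N] in
-- Two equal `N`-th powers would give `𝓑_m / X` a double zero.
theorem Generic.r_pow_ne (hP : Generic N P n) (hS : IsChoice N P S n) {m s s' : ℕ}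
    (hs : 1 ≤ s) (hsm : s < m) (hs' : 1 ≤ s') (hsm' : s' < m) (h2 : m ≤ n) (hne : s ≠ s') :
    S.r m s ^ N ≠ S.r m s' ^ N := fun h => by
  obtain ⟨_, hmul⟩ := hP.simple m (by omega) h2 _ (hS.isRoot hs hsm h2)
  have h0 : (Bcl N P m).divX ≠ 0 := fun h0 => by simp [h0] at hmul
  have : 2 ≤ (Bcl N P m).divX.rootMultiplicity (eps N * S.r m s ^ N) := by
    rw [le_rootMultiplicity_iff h0, hS.divX_Bcl (by omega) h2]
    refine Dvd.dvd.mul_left ?_ _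
    rw [← Finset.mul_prod_erase _ _ (show s ∈ Finset.Icc 1 (m - 1) by simp; omega),
      ← Finset.mul_prod_erase _ _ (show s' ∈ (Finset.Icc 1 (m - 1)).erase s by
        simp; omega), ← mul_assoc, ← h, sq]
    exact dvd_mul_right _ _
  omega

omit [NeZero N] in
theorem Generic.det_Tcl_ne (hP : Generic N P n) (hS : IsChoice N P S n) {m s k : ℕ}
    (hs : 1 ≤ s) (hsm : s < m) (h2 : m ≤ n) (hk : k ≤ n) :
    (Tcl N P k).det.eval (eps N * S.r m s ^ N) ≠ 0 := fun h => by
  obtain ⟨q, hq⟩ := det_Tcl_dvd N P hk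
  refine hP.det_ne m (by omega) h2 _ (hS.isRoot hs hsm h2) ?_
  rw [hq, eval_mul, h, zero_mul]

omit [NeZero N] in
theorem Generic.det_Lcl_ne (hP : Generic N P n) (hS : IsChoice N P S n) {m s k : ℕ}
    (hs : 1 ≤ s) (hsm : s < m) (h2 : m ≤ n) (hk : k + 1 ≤ n) :
    (Lcl N P (k + 1)).det.eval (eps N * S.r m s ^ N) ≠ 0 := fun h => by
  obtain ⟨q, hq⟩ := det_Lcl_dvd N P hk
  refine hP.det_ne m (by omega) h2 _ (hS.isRoot hs hsm h2) ?_
  rw [hq, eval_mul, h, zero_mul]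

/-- Neighbouring polynomials `𝓑_m`, `𝓑_{m+1}` have no common zero except `0`. -/
theorem Generic.r_pow_succ_ne (hP : Generic N P n) (hS : IsChoice N P S n) {m k l : ℕ}
    (hl : 1 ≤ l) (hlm : l < m) (hk : 1 ≤ k) (hkm : k ≤ m) (h2 : m + 1 ≤ n) :
    S.r (m + 1) k ^ N ≠ S.r m l ^ N := fun h => by
  have h3 := hS.eval_Bcl_eq_zero hk (Nat.lt_succ_of_le hkm) h2
  have h4 := hS.eval_Bcl_eq_zero hl hlm (by omega)
  have h5 := hP.det_Tcl_ne hS hl hlm (by omega) (show m ≤ n by omega)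
  have h6 : S.r m l ^ N ≠ 0 := pow_ne_zero _ (hP.r_ne_zero hS hlm (by omega))
  -- At a common zero the recursion forces `𝓐_m = 0` as well, so the first row of `𝓣_m` and hence
  -- its determinant would vanish.
  rw [h, Bcl_succ] at h3
  simp only [eval_add, eval_mul, h4, zero_mul, add_zero, eval_neg, eval_C, eval_X, mul_eq_zero,
    neg_eq_zero, eps_ne_zero, hP.r_ne (m + 1) (by omega) h2, h6, or_false] at h3
  rw [eval_Tcl_det, h3, h4] at h5
  simp at h5

/-! ### The points of the Fermat curve -/

/-- The Fermat equation is the recursion of `𝓑` in its leading coefficient, where `𝓐_{m+1}`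
contributes the product of the `ϰ_j`. -/
theorem Generic.regular_pZero (hP : Generic N P n) (hS : IsChoice N P S n) {m : ℕ}
    (h2 : m + 2 ≤ n) : Regular N (pZero P S (m + 2)) := by
  have hr := hP.r_zero_ne hS (m := m + 2) (by omega) h2
  refine ⟨?_, div_ne_zero (mul_ne_zero (Finset.prod_ne_zero_iff.mpr fun j hj => hP.kap_ne j
    (by simp at hj; omega) (by simp at hj; omega)) (hP.r1_ne hS (by omega) h2)) hr⟩
  have hr' : S.r (m + 2) 0 ^ N ≠ 0 := pow_ne_zero _ hr
  have e := eps_mul_self N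
  have h3 := Bcl_succ_coeff N P (m + 1) (m + 1)
  have h4 : (Bcl N P (m + 1)).coeff (m + 1 + 1) = 0 :=
    coeff_eq_zero_of_natDegree_lt (Nat.lt_succ_of_le (Tcl_row_degree N P (m + 1)).2)
  rw [hS.coeff_top_Bcl h2, h4, hS.coeff_top_Bcl (by omega), Acl_coeff_top,
    ← hS.r1_pow _ (by omega) h2] at h3
  have h5 : (-eps N) ^ (m + 1 + 1) ≠ 0 := pow_ne_zero _ (neg_ne_zero.mpr (eps_ne_zero N))
  have h6 : S.r (m + 2) 0 ^ N = (∏ j ∈ Finset.Icc 1 (m + 1), P.kap j) ^ N * S.r1 (m + 2) ^ N +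
      S.r (m + 1) 0 ^ N * P.a (m + 2) ^ N * P.c (m + 2) ^ N := by
    refine mul_left_cancel₀ h5 ?_
    rw [pow_succ _ (m + 1)] at h3 ⊢
    linear_combination h3
  simp only [OnFermat, pZero, div_pow, mul_pow]
  rw [← add_div, div_eq_one_iff_eq hr', h6]
  simp only [show m + 2 - 1 = m + 1 from rfl]
  ring

/-- The Fermat equation is the recursion of `𝓑` in the coefficient of `X`, where `𝓐_{m+1}`
contributes its constant term `1`. -/
theorem Generic.regular_pTil (hP : Generic N P n) (hS : IsChoice N P S n) {m : ℕ}
    (h2 : m + 2 ≤ n) : Regular N (pTil P S (m + 2)) := by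
  have hr := hP.rtil_ne hS h2
  refine ⟨?_, div_ne_zero (div_ne_zero (mul_ne_zero (mul_ne_zero (hP.b_ne _ (by omega) h2)
    (hP.d_ne _ (by omega) h2)) (hP.rtil_ne hS (by omega))) (hP.kap_ne _ (by omega) h2)) hr⟩
  have hr' : rtil S (m + 2) ^ N ≠ 0 := pow_ne_zero _ hr
  have h3 := Bcl_succ_coeff N P (m + 1) 0
  rw [zero_add, hS.coeff_one_Bcl h2, Acl_coeff_zero, hS.coeff_one_Bcl (by omega), Bcl_coeff_zero,
    ← hS.r1_pow _ (by omega) h2] at h3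
  have h6 : rtil S (m + 2) ^ N = S.r1 (m + 2) ^ N + rtil S (m + 1) ^ N *
      (P.b (m + 2) ^ N * P.d (m + 2) ^ N / P.kap (m + 2) ^ N) := by
    refine mul_left_cancel₀ (neg_ne_zero.mpr (eps_ne_zero N)) ?_
    linear_combination h3
  simp only [OnFermat, pTil, div_pow, mul_pow]
  rw [← add_div, div_eq_one_iff_eq hr', h6]
  simp only [show m + 2 - 1 = m + 1 from rfl]
  ring

theorem OnFermat.regular {p : ℂ × ℂ} (hp : OnFermat N p) (h : p.1 ^ N ≠ 1) : Regular N p :=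
  ⟨hp, fun h0 => h (by simpa [OnFermat, h0, zero_pow (NeZero.ne N)] using hp)⟩

theorem Generic.regular_pPair (hP : Generic N P n) (hS : IsChoice N P S n) {m k l : ℕ}
    (hl : 1 ≤ l) (hlm : l < m) (hk : 1 ≤ k) (hkm : k ≤ m) (h2 : m + 1 ≤ n) :
    Regular N (pPair S (m + 1) k m l) := by
  refine (hS.y_pow _ _ _ _ hk (by omega) h2 hl hlm (by omega)).regular ?_
  simp only [pPair, div_pow]
  rw [Ne, div_eq_one_iff_eq (pow_ne_zero _ (hP.r_ne_zero hS hlm (by omega)))]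
  exact hP.r_pow_succ_ne hS hl hlm hk hkm h2

theorem Generic.regular_pPair_same (hP : Generic N P n) (hS : IsChoice N P S n) {m k l : ℕ}
    (hl : 1 ≤ l) (hlm : l < m) (hk : 1 ≤ k) (hkm : k < m) (h2 : m ≤ n) (hne : k ≠ l) :
    Regular N (pPair S m l m k) := by
  refine (hS.y_pow _ _ _ _ hl (by omega) h2 hk hkm (by omega)).regular ?_
  simp only [pPair, div_pow]
  rw [Ne, div_eq_one_iff_eq (pow_ne_zero _ (hP.r_ne_zero hS hkm (by omega)))]
  exact hP.r_pow_ne hS hl hlm hk hkm h2 hne.symm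

omit [NeZero N] in
theorem Generic.factor_ne (hP : Generic N P n) (hS : IsChoice N P S n) {m l : ℕ}
    (hl : 1 ≤ l) (hlm : l < m) (h2 : m ≤ n) :
    P.b m ^ N - P.a m ^ N * P.kap m ^ N * S.r m l ^ N ≠ 0 ∧
      P.d m ^ N / P.kap m ^ N - P.c m ^ N * S.r m l ^ N ≠ 0 := by
  obtain ⟨k, rfl⟩ : ∃ k, m = k + 1 := ⟨m - 1, by omega⟩
  have := hP.det_Lcl_ne hS hl hlm h2 h2
  rw [det_Lcl_eval _ _ _ (hP.kap_ne _ (by omega) h2)] at this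
  exact mul_ne_zero_iff.mp this

theorem Generic.regular_pTilPair (hP : Generic N P n) (hS : IsChoice N P S n) {m l : ℕ}
    (hl : 1 ≤ l) (hlm : l < m) (h2 : m < n) : Regular N (pTilPair P S m l) := by
  refine (hS.yt_pow _ _ hl hlm h2).regular fun h => (hP.factor_ne hS hl hlm h2.le).2 ?_
  have hk : P.kap m ^ N ≠ 0 := pow_ne_zero _ (hP.kap_ne m (by omega) h2.le)
  have hc : P.c m ^ N ≠ 0 := pow_ne_zero _ (hP.c_ne m (by omega) h2)
  have hr : S.r m l ^ N ≠ 0 := pow_ne_zero _ (hP.r_ne_zero hS hlm h2.le)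
  simp only [pTilPair, div_pow, mul_pow] at h
  rw [div_eq_one_iff_eq (by positivity)] at h
  rw [h]
  field_simp
  ring

theorem prod_range_succ_eq_Icc (f : ℕ → ℂ) (m : ℕ) :
    ∏ s ∈ Finset.range (m + 1), f s = f 0 * ∏ s ∈ Finset.Icc 1 m, f s := by
  rw [Finset.prod_range_succ', mul_comm, Finset.range_eq_Ico, Finset.prod_Ico_add' f 0 m 1]
  congr 1

/-- The algebra of `yPt_pow`, every letter standing for an `N`-th power or a product built from
such. `R` belongs to `r_{m+2,l}`, `E` and `F` to the other amplitudes of levels `m + 2` and `m + 1`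
with positive second index, `G` and `H` to the differences of `R` with levels `m + 1` and `m + 3`.
The hypothesis `h` is the three-term relation, `hyt` the Fermat equation of `p̃_{m+2,l}`. -/
theorem yPt_pow_aux {m : ℕ} {R E F G yt a b c d k s2 s3 r10 r20 r30 : ℂ} {H : ℂ}
    (hR : R ≠ 0) (hE : E ≠ 0) (hF : F ≠ 0) (hG : G ≠ 0) (hyt0 : yt ≠ 0) (hb : b ≠ 0) (hc : c ≠ 0)
    (hk : k ≠ 0) (hs3 : s3 ≠ 0) (h20 : r20 ≠ 0) (h10 : r10 ≠ 0)
    (h : (-1) ^ (m + 2 + 1) * r30 * R * H * s2 =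
      -((b - a * k * R) * (d / k - c * R)) * s3 * ((-1) ^ (m + 1) * r10 * R * G))
    (hyt : yt = 1 - d / (k * c * R)) :
    r20 * (R * E) * r30 * s2 / (r10 * F * r20 * s3 * b * c * yt) * ((-R) ^ m / E) *
      (H / R ^ (m + 2) / ((-1) ^ m * G / F)) = 1 - a * k * R / b := by
  have hm : ((-1 : ℂ)) ^ m ≠ 0 := pow_ne_zero _ (by norm_num)
  have h' : r30 * H * s2 = -((b - a * k * R) * (d / k - c * R)) * s3 * r10 * G := by
    refine mul_left_cancel₀ (mul_ne_zero hm hR) ?_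
    rw [pow_succ, pow_add, pow_succ] at h
    linear_combination -h
  have e1 : d / k - c * R = -c * R * yt := by
    rw [hyt]; field_simp; ring
  rw [e1] at h'
  have e2 : r20 * (R * E) * r30 * s2 / (r10 * F * r20 * s3 * b * c * yt) * ((-R) ^ m / E) *
      (H / R ^ (m + 2) / ((-1) ^ m * G / F)) =
      r30 * H * s2 / (R * r10 * s3 * b * c * yt * G) := by
    rw [neg_pow]
    field_simp
    ring
  rw [e2, h']
  field_simp

/-- Since `y_{m,l}` is prescribed by a relation, its Fermat equation is a genuine claim. In the
`N`-th power of that relation, the products of differences are, up to explicit factors, the values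
of `𝓑_{m+1}` and `𝓑_{m+3}` at a zero of `𝓑_{m+2}`. The three-term relation replaces their ratio by
`det 𝓛_{m+2}`; one factor of it cancels `ỹ ^ N`, the other is the right-hand side times `b ^ N`. -/
theorem Generic.yPt_pow (hP : Generic N P n) (hS : IsChoice N P S n) {m l : ℕ}
    (hl : 1 ≤ l) (hlm : l ≤ m + 1) (h2 : m + 3 ≤ n) :
    yPt P S (m + 2) l ^ N =
      1 - P.a (m + 2) ^ N * P.kap (m + 2) ^ N * S.r (m + 2) l ^ N / P.b (m + 2) ^ N := by
  have hlm' : l < m + 2 := by omega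
  have hr : ∀ j s, s < j → j ≤ n → S.r j s ^ N ≠ 0 := fun j s h h' =>
    pow_ne_zero _ (hP.r_ne_zero hS h h')
  have hR := hr (m + 2) l hlm' (by omega)
  have hlI : l ∈ Finset.Icc 1 (m + 1) := by simp; omega
  have hys : ∀ j s j' s', 1 ≤ s → s < j → j ≤ n → 1 ≤ s' → s' < j' → j' ≤ n →
      S.y j s j' s' ^ N = 1 - S.r j s ^ N / S.r j' s' ^ N := fun j s j' s' a1 a2 a3 a4 a5 a6 => by
    have := hS.y_pow j s j' s' a1 a2 a3 a4 a5 a6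
    simp only [OnFermat, pPair, div_pow] at this
    linear_combination this
  have hyt : S.yt (m + 2) l ^ N = 1 - P.d (m + 2) ^ N /
      (P.kap (m + 2) ^ N * P.c (m + 2) ^ N * S.r (m + 2) l ^ N) := by
    have := hS.yt_pow (m + 2) l hl hlm' (by omega)
    simp only [OnFermat, pTilPair, div_pow, mul_pow] at this
    linear_combination this
  -- The difference of the two amplitudes occurs in both `y`s with opposite signs and cancels,
  -- leaving minus the ratio of the `N`-th powers.
  have q1 : ∏ s ∈ (Finset.Icc 1 (m + 1)).erase l,
      (S.y (m + 2) l (m + 2) s / S.y (m + 2) s (m + 2) l) ^ N =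
      (-S.r (m + 2) l ^ N) ^ m / ∏ s ∈ (Finset.Icc 1 (m + 1)).erase l, S.r (m + 2) s ^ N := by
    have hc : (-S.r (m + 2) l ^ N) ^ m =
        ∏ s ∈ (Finset.Icc 1 (m + 1)).erase l, (-S.r (m + 2) l ^ N) := by
      rw [Finset.prod_const, Finset.card_erase_of_mem hlI]; simp
    rw [hc, ← Finset.prod_div_distrib]
    refine Finset.prod_congr rfl fun s hs => ?_
    simp only [Finset.mem_erase, Finset.mem_Icc] at hs
    have hRs := hr (m + 2) s (by omega) (by omega)
    have hne := sub_ne_zero.mpr (hP.r_pow_ne hS hl hlm' hs.2.1 (by omega) (by omega)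
      (Ne.symm hs.1))
    rw [div_pow, hys _ _ _ _ hl hlm' (by omega) hs.2.1 (by omega) (by omega),
      hys _ _ _ _ hs.2.1 (by omega) (by omega) hl hlm' (by omega)]
    have h1 : 1 - S.r (m + 2) l ^ N / S.r (m + 2) s ^ N =
        -(S.r (m + 2) l ^ N - S.r (m + 2) s ^ N) / S.r (m + 2) s ^ N := by
      field_simp; ring
    have h3 : 1 - S.r (m + 2) s ^ N / S.r (m + 2) l ^ N =
        (S.r (m + 2) l ^ N - S.r (m + 2) s ^ N) / S.r (m + 2) l ^ N := by
      field_simp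
    rw [h1, h3]
    field_simp
  have q2 : ∏ k ∈ Finset.Icc 1 (m + 2), S.y (m + 3) k (m + 2) l ^ N =
      (∏ k ∈ Finset.Icc 1 (m + 2), (S.r (m + 2) l ^ N - S.r (m + 3) k ^ N)) /
        (S.r (m + 2) l ^ N) ^ (m + 2) := by
    have hc : (S.r (m + 2) l ^ N) ^ (m + 2) =
        ∏ s ∈ Finset.Icc 1 (m + 2), (S.r (m + 2) l ^ N) := by
      rw [Finset.prod_const]; simp
    rw [hc, ← Finset.prod_div_distrib]
    refine Finset.prod_congr rfl fun s hs => ?_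
    simp only [Finset.mem_Icc] at hs
    rw [hys _ _ _ _ hs.1 (by omega) (by omega) hl hlm' (by omega)]
    field_simp
  have q3 : ∏ s ∈ Finset.Icc 1 m, S.y (m + 2) l (m + 1) s ^ N =
      (-1) ^ m * (∏ s ∈ Finset.Icc 1 m, (S.r (m + 2) l ^ N - S.r (m + 1) s ^ N)) /
        ∏ s ∈ Finset.Icc 1 m, S.r (m + 1) s ^ N := by
    have hc : (-1 : ℂ) ^ m = ∏ s ∈ Finset.Icc 1 m, (-1) := by
      rw [Finset.prod_const]; simp
    rw [hc, ← Finset.prod_mul_distrib, ← Finset.prod_div_distrib]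
    refine Finset.prod_congr rfl fun s hs => ?_
    simp only [Finset.mem_Icc] at hs
    have hRs := hr (m + 1) s (by omega) (by omega)
    rw [hys _ _ _ _ hl hlm' (by omega) hs.1 (by omega) (by omega)]
    field_simp
    ring
  have h3 := hS.eval_Bcl_three_term hl hlm' h2
  rw [hS.eval_Bcl h2, det_Lcl_eval _ _ _ (hP.kap_ne _ (by omega) (by omega)),
    hS.eval_Bcl (show m + 1 ≤ n by omega)] at h3
  have t2 : rtil S (m + 2) ^ N = S.r (m + 2) 0 ^ N * (S.r (m + 2) l ^ N *
      ∏ s ∈ (Finset.Icc 1 (m + 1)).erase l, S.r (m + 2) s ^ N) := by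
    rw [Finset.mul_prod_erase (Finset.Icc 1 (m + 1)) (fun s => S.r (m + 2) s ^ N) hlI, rtil,
      prod_range_succ_eq_Icc, mul_pow, Finset.prod_pow]
  have t1 : rtil S (m + 1) ^ N = S.r (m + 1) 0 ^ N * ∏ s ∈ Finset.Icc 1 m, S.r (m + 1) s ^ N := by
    rw [rtil, prod_range_succ_eq_Icc, mul_pow, Finset.prod_pow]
  have e : yPt P S (m + 2) l ^ N =
      rtil S (m + 2) ^ N * S.r (m + 3) 0 ^ N * S.r1 (m + 2) ^ N /
      (rtil S (m + 1) ^ N * S.r (m + 2) 0 ^ N * S.r1 (m + 3) ^ N * P.b (m + 2) ^ N *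
        P.c (m + 2) ^ N * S.yt (m + 2) l ^ N) *
      (∏ s ∈ (Finset.Icc 1 (m + 1)).erase l,
        (S.y (m + 2) l (m + 2) s / S.y (m + 2) s (m + 2) l) ^ N) *
      ((∏ k ∈ Finset.Icc 1 (m + 2), S.y (m + 3) k (m + 2) l ^ N) /
        ∏ s ∈ Finset.Icc 1 m, S.y (m + 2) l (m + 1) s ^ N) := by
    simp only [yPt, mul_pow, div_pow, ← Finset.prod_pow]
    rfl
  have hE : ∏ s ∈ (Finset.Icc 1 (m + 1)).erase l, S.r (m + 2) s ^ N ≠ 0 :=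
    Finset.prod_ne_zero_iff.mpr fun s hs => hr _ _ (by
      simp only [Finset.mem_erase, Finset.mem_Icc] at hs; omega) (by omega)
  have hF : ∏ s ∈ Finset.Icc 1 m, S.r (m + 1) s ^ N ≠ 0 :=
    Finset.prod_ne_zero_iff.mpr fun s hs => hr _ _ (by
      simp only [Finset.mem_Icc] at hs; omega) (by omega)
  have hG : ∏ s ∈ Finset.Icc 1 m, (S.r (m + 2) l ^ N - S.r (m + 1) s ^ N) ≠ 0 :=
    Finset.prod_ne_zero_iff.mpr fun s hs => by
      simp only [Finset.mem_Icc] at hs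
      exact sub_ne_zero.mpr
        (hP.r_pow_succ_ne hS hs.1 (by omega) hl (by omega) (by omega))
  have hyt0 : S.yt (m + 2) l ^ N ≠ 0 :=
    pow_ne_zero _ (hP.regular_pTilPair hS hl hlm' (by omega)).2
  have hb : P.b (m + 2) ^ N ≠ 0 := pow_ne_zero _ (hP.b_ne _ (by omega) (by omega))
  have hc : P.c (m + 2) ^ N ≠ 0 := pow_ne_zero _ (hP.c_ne _ (by omega) (by omega))
  have hk : P.kap (m + 2) ^ N ≠ 0 := pow_ne_zero _ (hP.kap_ne _ (by omega) (by omega))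
  have hr3 : S.r1 (m + 3) ^ N ≠ 0 := pow_ne_zero _ (hP.r1_ne hS (by omega) (by omega))
  have h20 := hr (m + 2) 0 (by omega) (by omega)
  have h10 := hr (m + 1) 0 (by omega) (by omega)
  rw [e, q1, q2, q3, t1, t2]
  exact yPt_pow_aux hR hE hF hG hyt0 hb hc hk hr3 h20 h10 h3 hyt

theorem Generic.regular_pPt (hP : Generic N P n) (hS : IsChoice N P S n) {m l : ℕ}
    (hl : 1 ≤ l) (hlm : l < m) (h2 : m < n) : Regular N (pPt P S m l) := by
  obtain ⟨k, rfl⟩ : ∃ k, m = k + 2 := ⟨m - 2, by omega⟩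
  refine OnFermat.regular ?_ fun h => (hP.factor_ne hS hl hlm h2.le).1 ?_
  · simp only [OnFermat, pPt]
    rw [hP.yPt_pow hS hl (by omega) h2, div_pow, mul_pow, mul_pow]
    ring
  · have hb : P.b (k + 2) ^ N ≠ 0 := pow_ne_zero _ (hP.b_ne _ (by omega) h2.le)
    simp only [pPt, div_pow, mul_pow, div_eq_one_iff_eq hb] at h
    rw [h, sub_self]

end Zeros

/-! ### Operators on the first sites of a longer chain -/

/-- The extension `X ⊗ 1` of an operator on the first `n` sites to the chain with `n + 1` sites. -/
def liftHom (N n : ℕ) : Module.End ℂ (State N n) →+* Module.End ℂ (State N (n + 1)) where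
  toFun X :=
    { toFun := fun f γ =>
        X (fun δ => f (Fin.snoc (α := fun _ => ZMod N) δ (γ (Fin.last n)))) (Fin.init γ)
      map_add' := fun f g => by
        funext γ
        exact congrFun (X.map_add _ _) _
      map_smul' := fun c f => by
        funext γ
        exact congrFun (X.map_smul c _) _ }
  map_one' := by
    refine LinearMap.ext fun f => funext fun γ => ?_
    simp
  map_mul' X Y := by
    refine LinearMap.ext fun f => funext fun γ => ?_
    simp
  map_zero' := by
    refine LinearMap.ext fun f => funext fun γ => ?_
    simp
  map_add' X Y := by
    refine LinearMap.ext fun f => funext fun γ => ?_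
    simp

section Operators

variable {N n : ℕ}

theorem liftHom_apply (X : Module.End ℂ (State N n)) (f : State N (n + 1))
    (γ : Fin (n + 1) → ZMod N) : liftHom N n X f γ =
      X (fun δ => f (Fin.snoc (α := fun _ => ZMod N) δ (γ (Fin.last n)))) (Fin.init γ) := rfl

theorem liftHom_smul (c : ℂ) (X : Module.End ℂ (State N n)) :
    liftHom N n (c • X) = c • liftHom N n X := by
  refine LinearMap.ext fun f => funext fun γ => ?_
  simp [liftHom_apply]

theorem liftHom_tens (X : Module.End ℂ (State N n)) (f : State N n) (g : ZMod N → ℂ) :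
    liftHom N n X (tens f g) = tens (X f) g := by
  funext γ
  have : (fun δ => tens f g (Fin.snoc (α := fun _ => ZMod N) δ (γ (Fin.last n)))) =
      g (γ (Fin.last n)) • f := by
    funext δ
    simp [tens, mul_comm]
  rw [liftHom_apply, this, map_smul]
  simp [tens, mul_comm]

theorem liftHom_vOp (k : Fin n) : liftHom N n (vOp k) = vOp k.castSucc := by
  refine LinearMap.ext fun f => funext fun γ => ?_
  rw [liftHom_apply]
  simp only [vOp, LinearMap.funLeft_apply]
  rw [Fin.snoc_update, Fin.snoc_init_self]
  rfl

theorem vOp_last_tens (f : State N n) (g : ZMod N → ℂ) :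
    vOp (Fin.last n) (tens f g) = tens f fun γ => g (γ - 1) := by
  funext γ
  simp [vOp, LinearMap.funLeft_apply, tens]

theorem V_succ : V N (n + 1) = liftHom N n (V N n) * vOp (Fin.last n) := by
  rw [V, V, List.ofFn_succ', List.concat_eq_append, List.prod_append, List.prod_singleton,
    map_list_prod, List.map_ofFn]
  congr 3
  funext k
  exact (liftHom_vOp k).symm

variable [NeZero N]

theorem liftHom_uOp (k : Fin n) : liftHom N n (uOp k) = uOp k.castSucc := by
  refine LinearMap.ext fun f => funext fun γ => ?_
  rw [liftHom_apply]
  simp [uOp, Fin.init]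

theorem liftHom_uInv (k : Fin n) : liftHom N n (uInv k) = uInv k.castSucc := by
  refine LinearMap.ext fun f => funext fun γ => ?_
  rw [liftHom_apply]
  simp [uInv, Fin.init]

theorem uInv_last_tens (f : State N n) (g : ZMod N → ℂ) :
    uInv (Fin.last n) (tens f g) = tens f fun γ => ph (-γ) * g γ := by
  funext γ
  simp [uInv, tens, mul_left_comm]

/-- Lifting changes the tensor factor only formally and keeps the site number `j` of the parameters;
this is why `LOp` takes both. -/
theorem LOp_map (P : Params) (j : ℕ) (k : Fin n) (z : ℂ) :
    (LOp P j k z).map (liftHom N n) = LOp P j k.castSucc z := by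
  ext a b : 2
  fin_cases a <;> fin_cases b <;>
    simp [LOp, liftHom_smul, liftHom_vOp, liftHom_uOp, liftHom_uInv]

theorem T_succ (P : Params) (z : ℂ) :
    T (N := N) P (n + 1) z = (T P n z).map (liftHom N n) * LOp P (n + 1) (Fin.last n) z := by
  rw [T, T, List.ofFn_succ', List.concat_eq_append, List.prod_append, List.prod_singleton]
  have h := map_list_prod ((liftHom N n).mapMatrix (m := Fin 2))
    (List.ofFn fun k : Fin n => LOp (N := N) P (k + 1) k z)
  rw [RingHom.mapMatrix_apply, List.map_ofFn] at h
  rw [h]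
  congr 3
  funext k
  exact (LOp_map P _ k z).symm

theorem A_succ_apply (P : Params) (z : ℂ) (f : State N (n + 1)) :
    A P (n + 1) z f = liftHom N n (A P n z) (f + (z * P.kap (n + 1)) • vOp (Fin.last n) f) +
      liftHom N n (B P n z)
        (uOp (Fin.last n) (P.c (n + 1) • f - P.d (n + 1) • vOp (Fin.last n) f)) := by
  rw [A, T_succ, Matrix.mul_apply, Fin.sum_univ_two]
  simp [LOp, A, B]

theorem B_succ_apply (P : Params) (z : ℂ) (f : State N (n + 1)) :
    B P (n + 1) z f = liftHom N n (A P n z)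
        (z • uInv (Fin.last n) (P.a (n + 1) • f - P.b (n + 1) • vOp (Fin.last n) f)) +
      liftHom N n (B P n z) ((z * P.a (n + 1) * P.c (n + 1)) • f +
        (P.b (n + 1) * P.d (n + 1) / P.kap (n + 1)) • vOp (Fin.last n) f) := by
  rw [B, T_succ, Matrix.mul_apply, Fin.sum_univ_two]
  simp [LOp, A, B]

/-! ### The one-site vectors -/

theorem ph_ne_zero (γ : ZMod N) : ph γ ≠ 0 := by
  intro h
  have := ph_add γ (-γ)
  rw [add_neg_cancel, ph_zero, h, zero_mul] at this
  exact one_ne_zero this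

theorem ph_neg (γ : ZMod N) : ph (-γ) = (ph γ)⁻¹ := by
  exact eq_inv_of_mul_eq_one_left (by rw [← ph_add, neg_add_cancel, ph_zero])

theorem ph_sub (γ δ : ZMod N) : ph (γ - δ) = ph γ / ph δ := by
  rw [sub_eq_add_neg, ph_add, ph_neg, div_eq_mul_inv]

theorem ph_sum {ι : Type*} (s : Finset ι) (f : ι → ZMod N) :
    ph (∑ i ∈ s, f i) = ∏ i ∈ s, ph (f i) := by
  classical
  induction s using Finset.induction_on with
  | empty => simp [ph_zero]
  | insert a s ha ih => rw [Finset.sum_insert ha, Finset.prod_insert ha, ph_add, ih]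

theorem one_sub_ph_ne {p : ℂ × ℂ} (hp : Regular N p) (γ : ZMod N) : 1 - ph γ * p.1 ≠ 0 := by
  rw [ph_eq_pow]; exact one_sub_ne hp _

theorem w_step {p : ℂ × ℂ} (hp : Regular N p) (γ : ZMod N) :
    w p γ * (1 - ph γ * p.1) = p.2 * w p (γ - 1) := by
  have := w_rec hp γ
  rwa [div_eq_div_iff (w_ne_zero hp _) (one_sub_ph_ne hp γ)] at this

theorem psi_sub_one (P : Params) (S : Choice) (k : ℕ) (q : ZMod N) :
    (fun γ => psi P S k q (γ - 1)) = psi P S k (q + 1) := by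
  funext γ
  simp only [psi]
  congr 1
  ring

/-- The label `q + 1` stands for the action of `v` (`psi_sub_one`). The eigenvalue equation of `u⁻¹
(a - b v)` is the difference equation of `w` at the point `p_k` with denominators cleared. -/
theorem psi_eigen (P : Params) (S : Choice) {k : ℕ} (ha : P.a k ≠ 0)
    (hp : Regular N (pSite P S k)) (q γ : ZMod N) :
    ph (-γ) * (P.a k * psi P S k q γ - P.b k * psi P S k (q + 1) γ) =
      S.r1 k * ph (-q) * psi P S k q γ := by
  have h := w_step hp (γ - q)
  simp only [pSite] at h
  field_simp at h
  have e : γ - q - 1 = γ - (q + 1) := by ring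
  rw [e, ph_sub] at h
  have hq := ph_ne_zero q
  have hγ := ph_ne_zero γ
  simp only [psi, ph_neg, pSite]
  field_simp at h ⊢
  linear_combination h

end Operators

/-! ### Interpolation with a prescribed top coefficient -/

section Interpolation

variable {m : ℕ}

/-- The polynomial `p₀ ∏ (1 - X / ν_s) + p₁ X ∏ (X - ν_s) + ∑_k h_k X ∏_{s ≠ k} (X - ν_s)`. -/
def interp (ν : Fin m → ℂ) (p₀ p₁ : ℂ) (h : Fin m → ℂ) : ℂ[X] :=
  C p₀ * ∏ s, (1 - C (ν s)⁻¹ * X) + C p₁ * (X * ∏ s, (X - C (ν s))) +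
    ∑ k, C (h k) * (X * ∏ s ∈ Finset.univ.erase k, (X - C (ν s)))

theorem eval_interp (ν : Fin m → ℂ) (p₀ p₁ : ℂ) (h : Fin m → ℂ) (z : ℂ) :
    (interp ν p₀ p₁ h).eval z = p₀ * ∏ s, (1 - z / ν s) + p₁ * (z * ∏ s, (z - ν s)) +
      ∑ k, h k * (z * ∏ s ∈ Finset.univ.erase k, (z - ν s)) := by
  simp only [interp, eval_add, eval_mul, eval_prod, eval_sub, eval_C, eval_X, eval_one,
    eval_finsetSum]
  congr 3
  exact Finset.prod_congr rfl fun s _ => by rw [div_eq_inv_mul]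

theorem natDegree_prod_X_sub (s : Finset (Fin m)) (ν : Fin m → ℂ) :
    (∏ i ∈ s, (X - C (ν i))).natDegree = s.card := by
  rw [natDegree_prod_of_monic _ _ fun _ _ => monic_X_sub_C _]
  simp only [natDegree_X_sub_C]; simp

theorem coeff_prod_X_sub (ν : Fin m → ℂ) : (∏ i, (X - C (ν i))).coeff m = 1 := by
  have hm : (∏ i, (X - C (ν i))).Monic := monic_prod_of_monic _ _ fun _ _ => monic_X_sub_C _
  have := hm.coeff_natDegree
  rwa [natDegree_prod_X_sub, Finset.card_fin] at this

theorem natDegree_prod_one_sub (ν : Fin m → ℂ) :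
    (∏ s, (1 - C (ν s)⁻¹ * X)).natDegree ≤ m := by
  refine (natDegree_prod_le _ _).trans ?_
  refine (Finset.sum_le_card_nsmul _ _ 1 fun i _ => ?_).trans (by simp)
  compute_degree

theorem natDegree_interp_le (ν : Fin m → ℂ) (p₀ p₁ : ℂ) (h : Fin m → ℂ) :
    (interp ν p₀ p₁ h).natDegree ≤ m + 1 := by
  refine (natDegree_add_le _ _).trans (max_le ((natDegree_add_le _ _).trans (max_le ?_ ?_)) ?_)
  · exact (natDegree_C_mul_le _ _).trans ((natDegree_prod_one_sub ν).trans (Nat.le_succ m))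
  · refine (natDegree_C_mul_le _ _).trans (natDegree_mul_le.trans ?_)
    rw [natDegree_prod_X_sub, natDegree_X, Finset.card_fin, add_comm]
  · refine natDegree_sum_le_of_forall_le _ _ fun k _ => ?_
    refine (natDegree_C_mul_le _ _).trans (natDegree_mul_le.trans ?_)
    rw [natDegree_prod_X_sub, natDegree_X, add_comm]
    exact Nat.succ_le_succ ((Finset.card_le_univ _).trans (by simp))

theorem coeff_interp (ν : Fin m → ℂ) (p₀ p₁ : ℂ) (h : Fin m → ℂ) :
    (interp ν p₀ p₁ h).coeff (m + 1) = p₁ := by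
  rw [interp, coeff_add, coeff_add, coeff_C_mul, coeff_C_mul, coeff_X_mul, coeff_prod_X_sub,
    coeff_eq_zero_of_natDegree_lt (Nat.lt_succ_of_le (natDegree_prod_one_sub ν)), finsetSum_coeff,
    Finset.sum_eq_zero]
  · ring
  · intro k _
    rw [coeff_C_mul, coeff_X_mul, coeff_eq_zero_of_natDegree_lt, mul_zero]
    rw [natDegree_prod_X_sub]
    exact (Finset.card_erase_lt_of_mem (Finset.mem_univ k)).trans_le (by simp)

/-- The difference of the two sides has no term of degree `m + 1`, so degree at most `m`, but it
vanishes at the `m + 1` distinct points `0` and `ν k`. -/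
theorem eq_interp {ν : Fin m → ℂ} (hν : ∀ s, ν s ≠ 0) (hinj : Function.Injective ν) {p : ℂ[X]}
    (hp : p.natDegree ≤ m + 1) :
    p = interp ν (p.eval 0) (p.coeff (m + 1)) fun k =>
      p.eval (ν k) / (ν k * ∏ s ∈ Finset.univ.erase k, (ν k - ν s)) := by
  rw [← sub_eq_zero]
  set D := p - interp ν (p.eval 0) (p.coeff (m + 1)) fun k =>
      p.eval (ν k) / (ν k * ∏ s ∈ Finset.univ.erase k, (ν k - ν s)) with hD
  have hdeg : D.natDegree ≤ m + 1 :=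
    (natDegree_sub_le _ _).trans (max_le hp (natDegree_interp_le _ _ _ _))
  have htop : D.coeff (m + 1) = 0 := by rw [hD, coeff_sub, coeff_interp, sub_self]
  -- The nodes are indexed by `Option (Fin m)`, with `none` for the extra node `0`.
  have hlt : D.degree < (Finset.univ.image (fun i : Option (Fin m) => i.elim 0 ν)).card := by
    rw [Finset.card_image_of_injective]
    · simp only [Finset.card_univ, Fintype.card_option, Fintype.card_fin]
      rw [degree_lt_iff_coeff_zero]
      intro k hk
      rcases hk.eq_or_lt with rfl | h
      · exact htop
      · exact coeff_eq_zero_of_natDegree_lt (hdeg.trans_lt h)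
    · rintro (_ | i) (_ | j) h
      · rfl
      · exact absurd h.symm (hν j)
      · exact absurd h (hν i)
      · exact congrArg some (hinj h)
  refine eq_zero_of_degree_lt_of_eval_finset_eq_zero _ hlt fun x hx => ?_
  obtain ⟨i, -, rfl⟩ := Finset.mem_image.mp hx
  rcases i with _ | k
  · simp [hD, eval_interp]
  · have h0 : ∏ s ∈ Finset.univ.erase k, (ν k - ν s) ≠ 0 :=
      Finset.prod_ne_zero_iff.mpr fun s hs =>
        sub_ne_zero.mpr fun h => Finset.ne_of_mem_erase hs (hinj h).symm
    have h1 : ∏ s, (1 - ν k / ν s) = 0 :=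
      Finset.prod_eq_zero (Finset.mem_univ k) (by rw [div_self (hν k), sub_self])
    have h2 : ∏ s, (ν k - ν s) = 0 :=
      Finset.prod_eq_zero (Finset.mem_univ k) (sub_self _)
    simp only [Option.elim, hD, eval_sub, eval_interp, h1, h2, mul_zero, zero_add]
    rw [Finset.sum_eq_single k]
    · have := hν k
      field_simp
      ring
    · intro j _ hj
      have hz : ∏ s ∈ Finset.univ.erase j, (ν k - ν s) = 0 :=
        Finset.prod_eq_zero (Finset.mem_erase.mpr ⟨hj.symm, Finset.mem_univ k⟩) (sub_self _)
      rw [hz, mul_zero, mul_zero]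
    · simp

end Interpolation

/-! ### Ratios of the coefficients `Q` -/

/-- The label `ρ` with `ρ_k` replaced by `ρ_k - 1`. -/
def lower {N n : ℕ} (ρ : Fin n → ZMod N) (k : Fin n) : Fin n → ZMod N :=
  Function.update ρ k (ρ k - 1)

section Labels

variable {N n : ℕ}

theorem sum_raise (ρ : Fin n → ZMod N) (k : Fin n) : ∑ i, raise ρ k i = ∑ i, ρ i + 1 := by
  rw [raise, Finset.sum_update_of_mem (Finset.mem_univ k), ← Finset.erase_eq,
    ← Finset.add_sum_erase _ ρ (Finset.mem_univ k)]
  ring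

theorem sum_lower (ρ : Fin n → ZMod N) (k : Fin n) : ∑ i, lower ρ k i = ∑ i, ρ i - 1 := by
  rw [lower, Finset.sum_update_of_mem (Finset.mem_univ k), ← Finset.erase_eq,
    ← Finset.add_sum_erase _ ρ (Finset.mem_univ k)]
  ring

theorem raise_same (ρ : Fin n → ZMod N) (k : Fin n) : raise ρ k k = ρ k + 1 :=
  Function.update_self ..

theorem raise_of_ne (ρ : Fin n → ZMod N) {k j : Fin n} (h : j ≠ k) : raise ρ k j = ρ j :=
  Function.update_of_ne h ..

theorem lower_same (ρ : Fin n → ZMod N) (k : Fin n) : lower ρ k k = ρ k - 1 :=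
  Function.update_self ..

theorem lower_of_ne (ρ : Fin n → ZMod N) {k j : Fin n} (h : j ≠ k) : lower ρ k j = ρ j :=
  Function.update_of_ne h ..

theorem lower_raise (ρ : Fin n → ZMod N) (k : Fin n) : lower (raise ρ k) k = ρ := by
  simp [lower, raise]

theorem raise_lower (ρ : Fin n → ZMod N) (k : Fin n) : raise (lower ρ k) k = ρ := by
  simp [lower, raise]

end Labels

theorem prod_Icc_eq_prod_fin (f : ℕ → ℂ) (m : ℕ) :
    ∏ s ∈ Finset.Icc 1 m, f s = ∏ l : Fin m, f (l + 1) := by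
  rw [Fin.prod_univ_eq_prod_range (fun i => f (i + 1)), Finset.range_eq_Ico,
    Finset.prod_Ico_add' f 0 m 1]
  rfl

theorem prod_Icc_erase_eq_prod_fin (f : ℕ → ℂ) {m : ℕ} (l : Fin m) :
    ∏ s ∈ (Finset.Icc 1 m).erase (l + 1), f s = ∏ j ∈ Finset.univ.erase l, f (j + 1) := by
  symm
  refine Finset.prod_bij (fun j _ => (j : ℕ) + 1) ?_ ?_ ?_ fun _ _ => rfl
  · intro j hj
    have := Finset.ne_of_mem_erase hj
    simp only [Finset.mem_erase, Finset.mem_Icc]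
    exact ⟨fun h => this (Fin.ext (by omega)), by omega⟩
  · intro i _ j _ h
    exact Fin.ext (by omega)
  · intro s hs
    simp only [Finset.mem_erase, Finset.mem_Icc] at hs
    refine ⟨⟨s - 1, by omega⟩, Finset.mem_erase.mpr ⟨fun h => ?_, Finset.mem_univ _⟩, ?_⟩
    · have := congrArg Fin.val h
      simp only at this
      omega
    · simp only; omega

theorem prod_ratio {ι : Type*} [Fintype ι] [DecidableEq ι] {f f' : ι → ℂ} {a : ℂ} (l : ι)
    (h1 : f l = a * f' l) (h2 : ∀ j, j ≠ l → f j = f' j) : ∏ j, f j = a * ∏ j, f' j := by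
  rw [← Finset.mul_prod_erase _ f (Finset.mem_univ l),
    ← Finset.mul_prod_erase _ f' (Finset.mem_univ l), h1, mul_assoc,
    Finset.prod_congr rfl fun j hj => h2 j (Finset.ne_of_mem_erase hj)]

theorem prod_prod_erase_split {ι : Type*} [Fintype ι] [DecidableEq ι] (G : ι → ι → ℂ) (l : ι) :
    ∏ j, ∏ i ∈ Finset.univ.erase j, G i j =
      (∏ i ∈ Finset.univ.erase l, (G i l * G l i)) *
        ∏ j ∈ Finset.univ.erase l, ∏ i ∈ (Finset.univ.erase j).erase l, G i j := by
  have h : ∀ j ∈ Finset.univ.erase l, ∏ i ∈ Finset.univ.erase j, G i j =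
      G l j * ∏ i ∈ (Finset.univ.erase j).erase l, G i j := fun j hj =>
    (Finset.mul_prod_erase _ (fun i => G i j)
      (Finset.mem_erase.mpr ⟨(Finset.ne_of_mem_erase hj).symm, Finset.mem_univ l⟩)).symm
  rw [← Finset.mul_prod_erase _ (fun j => ∏ i ∈ Finset.univ.erase j, G i j) (Finset.mem_univ l),
    Finset.prod_congr rfl h, Finset.prod_mul_distrib, Finset.prod_mul_distrib, mul_assoc]

/-- A change of the single label `l` affects only the ordered pairs containing `l`; the orders `(i,
l)` and `(l, i)` are compared together. -/
theorem prod_prod_erase_ratio {ι : Type*} [Fintype ι] [DecidableEq ι] {G G' : ι → ι → ℂ}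
    {a : ι → ℂ} (l : ι) (h1 : ∀ i, i ≠ l → G i l * G l i = a i * (G' i l * G' l i))
    (h2 : ∀ i j, i ≠ l → j ≠ l → G i j = G' i j) :
    ∏ j, ∏ i ∈ Finset.univ.erase j, G i j =
      (∏ i ∈ Finset.univ.erase l, a i) * ∏ j, ∏ i ∈ Finset.univ.erase j, G' i j := by
  have e1 : ∏ i ∈ Finset.univ.erase l, (G i l * G l i) =
      (∏ i ∈ Finset.univ.erase l, a i) * ∏ i ∈ Finset.univ.erase l, (G' i l * G' l i) := by
    rw [← Finset.prod_mul_distrib]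
    exact Finset.prod_congr rfl fun i hi => h1 i (Finset.ne_of_mem_erase hi)
  have e2 : ∏ j ∈ Finset.univ.erase l, ∏ i ∈ (Finset.univ.erase j).erase l, G i j =
      ∏ j ∈ Finset.univ.erase l, ∏ i ∈ (Finset.univ.erase j).erase l, G' i j :=
    Finset.prod_congr rfl fun j hj => Finset.prod_congr rfl fun i hi =>
      h2 i j (Finset.ne_of_mem_erase hi) (Finset.ne_of_mem_erase hj)
  rw [prod_prod_erase_split G l, prod_prod_erase_split G' l, e1, e2, mul_assoc]

section Ratios

variable {N : ℕ} [NeZero N] {P : Params} {S : Choice}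

/-- Besides the phase, `σ 0` enters `Q` only through the function of `p_{m+2,0}`, which takes one
step. -/
theorem Q_lower_zero {m : ℕ} (hp : Regular N (pZero P S (m + 2))) (σ : Fin (m + 1) → ZMod N)
    (q : ZMod N) (ρ : Fin (m + 2) → ZMod N) :
    Q P S m (lower σ 0) q ρ = ph (q - ρ 0) *
      ((1 - ph (ρ 0 - σ 0) * (pZero P S (m + 2)).1) / (pZero P S (m + 2)).2) * Q P S m σ q ρ := by
  have h := w_step hp (ρ 0 - σ 0)
  have h1 := w_ne_zero hp (ρ 0 - σ 0)
  have h2 := w_ne_zero hp (ρ 0 - σ 0 - 1)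
  have e1 : ∑ i, ρ i - (∑ i, σ i - 1) = (∑ i, ρ i - ∑ i, σ i) + 1 := by ring
  have e2 : ρ 0 - (σ 0 - 1) - 1 = ρ 0 - σ 0 := by ring
  have hs : ∀ l : Fin m, lower σ 0 l.succ = σ l.succ := fun l => lower_of_ne _ (Fin.succ_ne_zero l)
  simp only [Q, sum_lower, lower_same, hs, e1, e2, add_mul, one_mul, ph_add]
  have h3 : (1 - ph (ρ 0 - σ 0) * (pZero P S (m + 2)).1) / (pZero P S (m + 2)).2 =
      w (pZero P S (m + 2)) (ρ 0 - σ 0 - 1) / w (pZero P S (m + 2)) (ρ 0 - σ 0) := by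
    rw [div_eq_div_iff hp.2 h1]; linear_combination h
  rw [h3]
  field_simp

theorem Q_sub_one {m : ℕ} (hp : Regular N (pTil P S (m + 2))) (σ : Fin (m + 1) → ZMod N)
    (q : ZMod N) (ρ : Fin (m + 2) → ZMod N) :
    Q P S m σ (q - 1) ρ = ph (∑ i, σ i - ∑ i, ρ i) *
      ((1 - ph (∑ i, ρ i - q) * (pTil P S (m + 2)).1) / (pTil P S (m + 2)).2) *
        Q P S m σ q ρ := by
  have h := w_step hp (∑ i, ρ i - q)
  have h1 := w_ne_zero hp (∑ i, ρ i - q)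
  have h2 := w_ne_zero hp (∑ i, ρ i - q - 1)
  have e1 : (∑ i, ρ i - ∑ i, σ i) * (q - 1 - ρ 0) =
      (∑ i, ρ i - ∑ i, σ i) * (q - ρ 0) + (∑ i, σ i - ∑ i, ρ i) := by ring
  have e2 : ∑ i, ρ i - (q - 1) - 1 = ∑ i, ρ i - q := by ring
  simp only [Q, e1, e2, ph_add]
  have h3 : (1 - ph (∑ i, ρ i - q) * (pTil P S (m + 2)).1) / (pTil P S (m + 2)).2 =
      w (pTil P S (m + 2)) (∑ i, ρ i - q - 1) / w (pTil P S (m + 2)) (∑ i, ρ i - q) := by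
    rw [div_eq_div_iff hp.2 h1]; linear_combination h
  rw [h3]
  field_simp

/-- `Q` is invariant under raising `ρ 0`, `σ 0` and `q` together. This gives both the action of `V`
and the leading coefficient of `A`. -/
theorem Q_raise_zero {m : ℕ} (σ : Fin (m + 1) → ZMod N) (q : ZMod N) (ρ : Fin (m + 2) → ZMod N) :
    Q P S m σ q (raise ρ 0) = Q P S m (lower σ 0) (q - 1) ρ := by
  have hs : ∀ l : Fin m, lower σ 0 l.succ = σ l.succ := fun l => lower_of_ne _ (Fin.succ_ne_zero l)
  have hr : ∀ l : Fin (m + 1), raise ρ 0 l.succ = ρ l.succ :=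
    fun l => raise_of_ne _ (Fin.succ_ne_zero l)
  have e1 : (∑ i, ρ i + 1 - ∑ i, σ i) * (q - (ρ 0 + 1)) =
    (∑ i, ρ i - (∑ i, σ i - 1)) * (q - 1 - ρ 0) := by ring
  have e2 : ρ 0 + 1 - σ 0 - 1 = ρ 0 - (σ 0 - 1) - 1 := by ring
  have e3 : ∑ i, ρ i + 1 - q - 1 = ∑ i, ρ i - (q - 1) - 1 := by ring
  simp only [Q, sum_raise, sum_lower, raise_same, lower_same, hs, hr, e1, e2, e3]

/-- Comparing with `q - 1` keeps the argument of the function of `p̃_{m+2}` fixed, so only the phase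
and the pair factors with `ρ k.succ` change. -/
theorem Q_raise_succ {m : ℕ} (k : Fin (m + 1))
    (hp : ∀ l : Fin m, Regular N (pPair S (m + 2) (k + 1) (m + 1) (l + 1)))
    (σ : Fin (m + 1) → ZMod N) (q : ZMod N) (ρ : Fin (m + 2) → ZMod N) :
    Q P S m σ q (raise ρ k.succ) = ph (q - ρ 0 + (∑ i, ρ i - ∑ i, σ i)) *
      (∏ l : Fin m, (1 - ph (σ l.succ - ρ k.succ) * (S.r (m + 2) (k + 1) / S.r (m + 1) (l + 1))) /
        S.y (m + 2) (k + 1) (m + 1) (l + 1)) * Q P S m σ (q - 1) ρ := by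
  have h0 : raise ρ k.succ 0 = ρ 0 := raise_of_ne _ (Fin.succ_ne_zero k).symm
  have e1 : (∑ i, ρ i + 1 - ∑ i, σ i) * (q - ρ 0) =
    (q - ρ 0 + (∑ i, ρ i - ∑ i, σ i)) + (∑ i, ρ i - ∑ i, σ i) * (q - 1 - ρ 0) := by ring
  have e3 : ∑ i, ρ i + 1 - q - 1 = ∑ i, ρ i - (q - 1) - 1 := by ring
  have e4 : (∏ l : Fin m, ∏ j : Fin (m + 1),
      w (pPair S (m + 2) (j + 1) (m + 1) (l + 1)) (σ l.succ - raise ρ k.succ j.succ)) =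
      (∏ l : Fin m, (1 - ph (σ l.succ - ρ k.succ) * (S.r (m + 2) (k + 1) / S.r (m + 1) (l + 1))) /
        S.y (m + 2) (k + 1) (m + 1) (l + 1)) *
      ∏ l : Fin m, ∏ j : Fin (m + 1),
        w (pPair S (m + 2) (j + 1) (m + 1) (l + 1)) (σ l.succ - ρ j.succ) := by
    rw [← Finset.prod_mul_distrib]
    refine Finset.prod_congr rfl fun l _ => ?_
    rw [← Finset.mul_prod_erase _ _ (Finset.mem_univ k),
      ← Finset.mul_prod_erase _ (fun j : Fin (m + 1) =>
        w (pPair S (m + 2) (j + 1) (m + 1) (l + 1)) (σ l.succ - ρ j.succ)) (Finset.mem_univ k),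
      ← mul_assoc]
    congr 1
    · have h := w_step (hp l) (σ l.succ - ρ k.succ)
      have hy := (hp l).2
      have e : σ l.succ - (ρ k.succ + 1) = σ l.succ - ρ k.succ - 1 := by ring
      rw [raise_same, e]
      simp only [pPair] at h hy ⊢
      rw [div_mul_eq_mul_div, eq_div_iff hy]
      linear_combination -h
    · refine Finset.prod_congr rfl fun j hj => ?_
      rw [raise_of_ne]
      exact fun h => Finset.ne_of_mem_erase hj (Fin.succ_injective _ h)
  simp only [Q, sum_raise, h0, e1, e3, e4, ph_add]
  ring

theorem prod_pair_lower {m : ℕ} (l : Fin m)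
    (hp : ∀ k : Fin (m + 1), Regular N (pPair S (m + 2) (k + 1) (m + 1) (l + 1)))
    (σ : Fin (m + 1) → ZMod N) (ρ : Fin (m + 2) → ZMod N) :
    (∏ j : Fin m, ∏ k : Fin (m + 1),
      w (pPair S (m + 2) (k + 1) (m + 1) (j + 1)) (lower σ l.succ j.succ - ρ k.succ)) =
      (∏ k : Fin (m + 1),
        (1 - ph (σ l.succ - ρ k.succ) * (S.r (m + 2) (k + 1) / S.r (m + 1) (l + 1))) /
          S.y (m + 2) (k + 1) (m + 1) (l + 1)) *
      ∏ j : Fin m, ∏ k : Fin (m + 1),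
        w (pPair S (m + 2) (k + 1) (m + 1) (j + 1)) (σ j.succ - ρ k.succ) := by
  refine prod_ratio l ?_ fun j hj => ?_
  · rw [← Finset.prod_mul_distrib]
    refine Finset.prod_congr rfl fun k _ => ?_
    have h := w_step (hp k) (σ l.succ - ρ k.succ)
    have hy := (hp k).2
    have e : σ l.succ - 1 - ρ k.succ = σ l.succ - ρ k.succ - 1 := by ring
    rw [lower_same, e]
    simp only [pPair] at h hy ⊢
    rw [div_mul_eq_mul_div, eq_div_iff hy]
    linear_combination -h
  · rw [lower_of_ne _ fun h => hj (Fin.succ_injective _ h)]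

/-- The functions for `(i, l)` and `(l, i)` step in opposite directions; the step upwards is the
origin of the `+ 1` in the phase. -/
theorem prod_same_lower {m : ℕ} (l : Fin m)
    (hs : ∀ i j : Fin m, i ≠ j → Regular N (pPair S (m + 1) (i + 1) (m + 1) (j + 1)))
    (σ : Fin (m + 1) → ZMod N) :
    (∏ j : Fin m, ∏ i ∈ Finset.univ.erase j,
      w (pPair S (m + 1) (i + 1) (m + 1) (j + 1)) (σ j.succ - σ i.succ)) =
      (∏ i ∈ Finset.univ.erase l,
        (S.y (m + 1) (i + 1) (m + 1) (l + 1) /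
            (1 - ph (σ l.succ - σ i.succ) * (S.r (m + 1) (i + 1) / S.r (m + 1) (l + 1))) *
          ((1 - ph (σ i.succ - σ l.succ + 1) * (S.r (m + 1) (l + 1) / S.r (m + 1) (i + 1))) /
            S.y (m + 1) (l + 1) (m + 1) (i + 1)))) *
      ∏ j : Fin m, ∏ i ∈ Finset.univ.erase j, w (pPair S (m + 1) (i + 1) (m + 1) (j + 1))
        (lower σ l.succ j.succ - lower σ l.succ i.succ) := by
  have hne : ∀ j, j ≠ l → lower σ l.succ j.succ = σ j.succ := fun j hj =>
    lower_of_ne _ fun h => hj (Fin.succ_injective _ h)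
  refine prod_prod_erase_ratio
    (G := fun i j : Fin m => w (pPair S (m + 1) (i + 1) (m + 1) (j + 1)) (σ j.succ - σ i.succ))
    (G' := fun i j : Fin m => w (pPair S (m + 1) (i + 1) (m + 1) (j + 1))
      (lower σ l.succ j.succ - lower σ l.succ i.succ)) l (fun i hil => ?_) fun i j hi hj => ?_
  · have g1 := w_step (hs i l hil) (σ l.succ - σ i.succ)
    have g2 := w_step (hs l i hil.symm) (σ i.succ - σ l.succ + 1)
    have hy1 := (hs i l hil).2
    have hy2 := (hs l i hil.symm).2
    have d1 := one_sub_ph_ne (hs i l hil) (σ l.succ - σ i.succ)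
    have u1 : σ l.succ - 1 - σ i.succ = σ l.succ - σ i.succ - 1 := by ring
    have u2 : σ i.succ - (σ l.succ - 1) = σ i.succ - σ l.succ + 1 := by ring
    rw [add_sub_cancel_right] at g2
    simp only [lower_same, hne i hil, u1, u2]
    simp only [pPair] at g1 g2 hy1 hy2 d1 ⊢
    rw [div_mul_div_comm, div_mul_eq_mul_div, eq_div_iff (mul_ne_zero d1 hy2)]
    rw [show ∀ x1 x2 x3 x4 : ℂ, x1 * x2 * (x3 * x4) = (x1 * x3) * (x4 * x2) by intros; ring, g1,
      ← g2]
    ring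
  · simp only [hne i hi, hne j hj]

theorem prod_site_lower {m : ℕ} (l : Fin m)
    (hw : Regular N (pPt P S (m + 1) (l + 1))) (ht : Regular N (pTilPair P S (m + 1) (l + 1)))
    (σ : Fin (m + 1) → ZMod N) :
    (∏ j : Fin m, w (pPt P S (m + 1) (j + 1)) (-lower σ l.succ j.succ) /
        w (pTilPair P S (m + 1) (j + 1)) (lower σ l.succ j.succ)) =
      ((pPt P S (m + 1) (l + 1)).2 /
          (1 - ph (1 - σ l.succ) * (pPt P S (m + 1) (l + 1)).1) *
        (S.yt (m + 1) (l + 1) /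
          (1 - ph (σ l.succ) * (pTilPair P S (m + 1) (l + 1)).1))) *
      ∏ j : Fin m, w (pPt P S (m + 1) (j + 1)) (-σ j.succ) /
        w (pTilPair P S (m + 1) (j + 1)) (σ j.succ) := by
  refine prod_ratio l ?_ fun j hj => ?_
  · have g1 := w_step hw (1 - σ l.succ)
    have g2 := w_step ht (σ l.succ)
    have d1 := one_sub_ph_ne hw (1 - σ l.succ)
    have d2 := one_sub_ph_ne ht (σ l.succ)
    have w1 := w_ne_zero ht (σ l.succ)
    have w2 := w_ne_zero ht (σ l.succ - 1)
    have u1 : -(σ l.succ - 1) = 1 - σ l.succ := by ring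
    have u2 : 1 - σ l.succ - 1 = -σ l.succ := by ring
    rw [u2] at g1
    rw [lower_same, u1]
    have hyt : (pTilPair P S (m + 1) (l + 1)).2 = S.yt (m + 1) (l + 1) := rfl
    rw [hyt] at g2
    rw [div_mul_div_comm, div_mul_div_comm, div_eq_div_iff w2
      (mul_ne_zero (mul_ne_zero d1 d2) w1)]
    rw [show ∀ x1 x2 x3 x4 : ℂ, x1 * (x2 * x3 * x4) = (x1 * x2) * (x4 * x3) by intros; ring, g1,
      g2]
    ring
  · rw [lower_of_ne _ fun h => hj (Fin.succ_injective _ h)]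

theorem Q_lower_succ {m : ℕ} (l : Fin m)
    (hp : ∀ k : Fin (m + 1), Regular N (pPair S (m + 2) (k + 1) (m + 1) (l + 1)))
    (hs : ∀ i j : Fin m, i ≠ j → Regular N (pPair S (m + 1) (i + 1) (m + 1) (j + 1)))
    (hw : Regular N (pPt P S (m + 1) (l + 1))) (ht : Regular N (pTilPair P S (m + 1) (l + 1)))
    (σ : Fin (m + 1) → ZMod N) (q : ZMod N) (ρ : Fin (m + 2) → ZMod N) :
    Q P S m (lower σ l.succ) q ρ = ph (q - ρ 0) *
      (∏ k : Fin (m + 1),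
        (1 - ph (σ l.succ - ρ k.succ) * (S.r (m + 2) (k + 1) / S.r (m + 1) (l + 1))) /
          S.y (m + 2) (k + 1) (m + 1) (l + 1)) *
      (∏ i ∈ Finset.univ.erase l,
        (S.y (m + 1) (i + 1) (m + 1) (l + 1) /
            (1 - ph (σ l.succ - σ i.succ) * (S.r (m + 1) (i + 1) / S.r (m + 1) (l + 1))) *
          ((1 - ph (σ i.succ - σ l.succ + 1) * (S.r (m + 1) (l + 1) / S.r (m + 1) (i + 1))) /
            S.y (m + 1) (l + 1) (m + 1) (i + 1)))) *
      ((pPt P S (m + 1) (l + 1)).2 /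
          (1 - ph (1 - σ l.succ) * (pPt P S (m + 1) (l + 1)).1) *
        (S.yt (m + 1) (l + 1) /
          (1 - ph (σ l.succ) * (pTilPair P S (m + 1) (l + 1)).1))) *
      Q P S m σ q ρ := by
  have h0 : lower σ l.succ 0 = σ 0 := lower_of_ne _ (Fin.succ_ne_zero l).symm
  have e1 : (∑ i, ρ i - (∑ i, σ i - 1)) * (q - ρ 0) =
    (q - ρ 0) + (∑ i, ρ i - ∑ i, σ i) * (q - ρ 0) := by ring
  have hR : (∏ i ∈ Finset.univ.erase l,
        (S.y (m + 1) (i + 1) (m + 1) (l + 1) /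
            (1 - ph (σ l.succ - σ i.succ) * (S.r (m + 1) (i + 1) / S.r (m + 1) (l + 1))) *
          ((1 - ph (σ i.succ - σ l.succ + 1) * (S.r (m + 1) (l + 1) / S.r (m + 1) (i + 1))) /
            S.y (m + 1) (l + 1) (m + 1) (i + 1)))) ≠ 0 :=
    Finset.prod_ne_zero_iff.mpr fun i hi => by
      have hil := Finset.ne_of_mem_erase hi
      exact mul_ne_zero (div_ne_zero (hs i l hil).2 (one_sub_ph_ne (hs i l hil) _))
        (div_ne_zero (one_sub_ph_ne (hs l i hil.symm) _) (hs l i hil.symm).2)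
  simp only [Q, sum_lower, h0, e1, prod_pair_lower l hp, prod_same_lower l hs σ,
    prod_site_lower l hw ht,
    ph_add (q - ρ 0)]
  generalize (∏ i ∈ Finset.univ.erase l,
        (S.y (m + 1) (i + 1) (m + 1) (l + 1) /
            (1 - ph (σ l.succ - σ i.succ) * (S.r (m + 1) (i + 1) / S.r (m + 1) (l + 1))) *
          ((1 - ph (σ i.succ - σ l.succ + 1) * (S.r (m + 1) (l + 1) / S.r (m + 1) (i + 1))) /
            S.y (m + 1) (l + 1) (m + 1) (i + 1)))) = R at hR ⊢
  -- `prod_same_lower` expresses the denominator of the original `Q` as `R` times the lowered one,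
  -- so `R` must cancel against the factor in the claim.
  rw [div_mul_eq_div_div _ R, div_right_comm _ R]
  rw [show ∀ x1 x2 x3 x4 x5 x6 x7 : ℂ, x1 * x2 * R * x3 * (x4 * (x5 / x6 / R) * x7) =
    x1 * x2 * x3 * (x4 * (x5 / x6) * x7) * (R / R) by intros; ring, div_self hR]
  ring

end Ratios

/-! ### Difference equations of `Q` in terms of the zeros of the eigenvalues -/

section Identities

variable {N : ℕ} [NeZero N] {P : Params} {S : Choice}

/-- The eigenvalue of `B` on `Ψ_σ` at spectral parameter `z`. -/
def beta {m : ℕ} (S : Choice) (σ : Fin (m + 1) → ZMod N) (z : ℂ) : ℂ :=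
  z * (S.r (m + 1) 0 * ph (-σ 0)) * ∏ k : Fin m, (z + S.r (m + 1) (k + 1) * ph (-σ k.succ))

theorem beta_eq {m : ℕ} (σ : Fin (m + 1) → ZMod N) (z : ℂ) :
    beta S σ z = z * (S.r (m + 1) 0 * ph (-σ 0)) * ∏ k : Fin m, (z - lam S σ k.succ) := by
  simp [beta, lam]

/-- Both sides are the coefficient of `z` in the eigenvalue `beta S σ z`. -/
theorem rtil_mul_ph {m : ℕ} (S : Choice) (σ : Fin (m + 1) → ZMod N) :
    rtil S (m + 1) * ph (-∑ i, σ i) =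
      S.r (m + 1) 0 * ph (-σ 0) * ∏ k : Fin m, -lam S σ k.succ := by
  rw [rtil, prod_range_succ_eq_Icc, prod_Icc_eq_prod_fin, ← Finset.sum_neg_distrib, ph_sum,
    Fin.prod_univ_succ]
  simp only [lam, neg_neg, Finset.prod_mul_distrib, Fin.val_succ]
  ring

theorem lam_ne_zero {n : ℕ} {ρ : Fin n → ZMod N} {k : Fin n} (h : S.r n k ≠ 0) :
    lam S ρ k ≠ 0 :=
  neg_ne_zero.mpr (mul_ne_zero h (ph_ne_zero _))

theorem lam_pow {n : ℕ} (ρ : Fin n → ZMod N) (k : Fin n) :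
    lam S ρ k ^ N = (-1) ^ N * S.r n k ^ N := by
  have : ph (-ρ k) ^ N = 1 := by
    rw [ph_eq_pow, ← pow_mul, mul_comm, pow_mul, om_pow, one_pow]
  rw [lam, neg_pow, mul_pow, this, mul_one]

/-- Links the two languages: differences of zeros become the denominators `1 - ω ^ γ x` in the
difference equation of `w`. -/
theorem lam_sub_lam_fst {n n' : ℕ} (σ : Fin n → ZMod N) (ρ : Fin n' → ZMod N) (l : Fin n)
    (k : Fin n') (hr : S.r n l ≠ 0) :
    lam S σ l - lam S ρ k = lam S σ l * (1 - ph (σ l - ρ k) * (S.r n' k / S.r n l)) := by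
  have h1 := ph_ne_zero (σ l)
  have h2 := ph_ne_zero (ρ k)
  simp only [lam, ph_sub, ph_neg]
  field_simp
  ring

theorem lam_sub_lam_snd {n n' : ℕ} (σ : Fin n → ZMod N) (ρ : Fin n' → ZMod N) (l : Fin n)
    (k : Fin n') (hr : S.r n l ≠ 0) :
    lam S ρ k - lam S σ l = -lam S σ l * (1 - ph (σ l - ρ k) * (S.r n' k / S.r n l)) := by
  linear_combination -lam_sub_lam_fst σ ρ l k hr

theorem lam_lower_same {n : ℕ} (σ : Fin n → ZMod N) (l : Fin n) :
    lam S (lower σ l) l = om N * lam S σ l := by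
  rw [lam, lam, lower_same, neg_sub, ph_sub, ph_neg, om]
  ring

theorem lam_lower_of_ne {n : ℕ} (σ : Fin n → ZMod N) {l k : Fin n} (h : k ≠ l) :
    lam S (lower σ l) k = lam S σ k := by
  rw [lam, lam, lower_of_ne _ h]

theorem om_ne_zero : om N ≠ 0 := ph_ne_zero 1

/-- The quantum analogue of `det_Lcl_eval`: the factors of `F` are the denominators that arise when
the functions of `p_{n,l}` and `p̃_{n,l}` take a step. -/
theorem F_eq {n l : ℕ} (z γ : ℂ) (hb : P.b n ≠ 0) (hc : P.c n ≠ 0) (hk : P.kap n ≠ 0)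
    (hr : S.r n l ≠ 0) (hγ : γ ≠ 0) (hz : z = -(S.r n l * γ⁻¹)) : F N P n z =
      P.b n * P.c n * z * (1 - om N * γ⁻¹ * (pPt P S n l).1) *
        (1 - γ * (pTilPair P S n l).1) := by
  simp only [F, pPt, pTilPair, hz]
  field_simp
  ring

variable {n m : ℕ}

/-- Leading coefficient of the eigenvalue equation of `B`; it amounts to the difference equation at
`p_{m+2,0}`. -/
theorem Q_top_coeff (hP : Generic N P n) (hS : IsChoice N P S n) (hm : m + 2 ≤ n)
    (σ : Fin (m + 1) → ZMod N) (q : ZMod N) (ρ : Fin (m + 2) → ZMod N) :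
    S.r1 (m + 2) * ph (-q) * ((∏ j ∈ Finset.Icc 1 (m + 1), P.kap j) * Q P S m (lower σ 0) q ρ) +
      S.r (m + 1) 0 * ph (-σ 0) * (P.a (m + 2) * P.c (m + 2) * Q P S m σ q ρ) =
    S.r (m + 2) 0 * ph (-ρ 0) * Q P S m σ q ρ := by
  have hp := hP.regular_pZero hS hm
  have hr := hP.r_zero_ne hS (m := m + 2) (by omega) hm
  have hr1 := hP.r1_ne hS (m := m + 2) (by omega) hm
  have hK : ∏ j ∈ Finset.Icc 1 (m + 1), P.kap j ≠ 0 :=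
    Finset.prod_ne_zero_iff.mpr fun j hj => by
      simp only [Finset.mem_Icc] at hj
      exact hP.kap_ne j hj.1 (by omega)
  have h1 := ph_ne_zero q
  have h2 := ph_ne_zero (ρ 0)
  have h3 := ph_ne_zero (σ 0)
  rw [Q_lower_zero hp]
  simp only [pZero, show m + 2 - 1 = m + 1 from rfl, ph_sub, ph_neg]
  field_simp
  ring

/-- Constant term, after division by `z`, of the eigenvalue equation of `B`; it amounts to the
difference equation at `p̃_{m+2}`. -/
theorem Q_const_coeff (hP : Generic N P n) (hS : IsChoice N P S n) (hm : m + 2 ≤ n)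
    (σ : Fin (m + 1) → ZMod N) (q : ZMod N) (ρ : Fin (m + 2) → ZMod N) :
    S.r1 (m + 2) * ph (-q) * Q P S m σ q ρ +
      S.r (m + 1) 0 * ph (-σ 0) * (∏ k : Fin m, -lam S σ k.succ) *
        (P.b (m + 2) * P.d (m + 2) / P.kap (m + 2) * Q P S m σ (q - 1) ρ) =
    S.r (m + 2) 0 * ph (-ρ 0) * (∏ k : Fin (m + 1), -lam S ρ k.succ) * Q P S m σ q ρ := by
  have hp := hP.regular_pTil hS hm
  have hr2 := hP.rtil_ne hS hm
  have hr1 := hP.rtil_ne hS (m := m + 1) (by omega)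
  have hb := hP.b_ne (m + 2) (by omega) hm
  have hd := hP.d_ne (m + 2) (by omega) hm
  have hk := hP.kap_ne (m + 2) (by omega) hm
  rw [Q_sub_one hp, ← rtil_mul_ph, ← rtil_mul_ph]
  have h1 := ph_ne_zero q
  have h2 := ph_ne_zero (∑ i, ρ i)
  have h3 := ph_ne_zero (∑ i, σ i)
  simp only [pTil, show m + 2 - 1 = m + 1 from rfl, ph_sub, ph_neg]
  field_simp
  ring

/-- The pair factors in `Q_raise_succ` are, up to `y`s, those of `beta S σ` at a zero for `ρ`. They
absorb the dependence on `σ` and `q`, so that `phi` depends on `ρ` and `k` alone. -/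
theorem Q_raise_phi (hP : Generic N P n) (hS : IsChoice N P S n) (hm : m + 2 ≤ n)
    (k : Fin (m + 1)) (σ : Fin (m + 1) → ZMod N) (q : ZMod N) (ρ : Fin (m + 2) → ZMod N) :
    -(beta S σ (lam S ρ k.succ)) * ph q / (S.r1 (m + 2) * lam S ρ k.succ) *
      F N P (m + 2) (lam S ρ k.succ / om N) * Q P S m σ (q - 1) ρ =
    phi P S ρ k.succ * Q P S m σ q (raise ρ k.succ) := by
  have hreg : ∀ l : Fin m, Regular N (pPair S (m + 2) (k + 1) (m + 1) (l + 1)) := fun l =>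
    hP.regular_pPair hS (by omega) (by omega) (by omega) (by omega) hm
  have hr1 := hP.r1_ne hS (m := m + 2) (by omega) hm
  have hlam : lam S ρ k.succ ≠ 0 := lam_ne_zero (hP.r_ne_zero hS k.succ.2 hm)
  have hy : ∏ l : Fin m, S.y (m + 2) (k + 1) (m + 1) (l + 1) ≠ 0 :=
    Finset.prod_ne_zero_iff.mpr fun l _ => (hreg l).2
  have hb : beta S σ (lam S ρ k.succ) = lam S ρ k.succ * (rtil S (m + 1) * ph (-∑ i, σ i) *
      ∏ l : Fin m, (1 - ph (σ l.succ - ρ k.succ) *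
        (S.r (m + 2) (k + 1) / S.r (m + 1) (l + 1)))) := by
    rw [beta_eq, rtil_mul_ph]
    have : ∀ l : Fin m, lam S ρ k.succ - lam S σ l.succ = -lam S σ l.succ *
        (1 - ph (σ l.succ - ρ k.succ) * (S.r (m + 2) (k + 1) / S.r (m + 1) (l + 1))) :=
      fun l => lam_sub_lam_snd σ ρ l.succ k.succ (hP.r_ne_zero hS l.succ.2 (by omega))
    simp only [this, Finset.prod_mul_distrib]
    ring
  rw [Q_raise_succ k hreg, hb, phi, Finset.prod_div_distrib]
  simp only [Nat.add_sub_cancel, Fin.val_succ, show m + 1 + 1 = m + 2 from rfl]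
  rw [prod_Icc_eq_prod_fin]
  generalize (∏ l : Fin m, S.y (m + 2) (k + 1) (m + 1) (l + 1)) = Y at hy ⊢
  generalize (∏ l : Fin m, (1 - ph (σ l.succ - ρ k.succ) *
        (S.r (m + 2) (k + 1) / S.r (m + 1) (l + 1)))) = X
  generalize F N P (m + 2) (lam S ρ k.succ / om N) = FF
  generalize lam S ρ k.succ = L at hlam ⊢
  have h1 := ph_ne_zero (ρ 0)
  have h2 := ph_ne_zero (∑ i, ρ i)
  have h3 := ph_ne_zero (∑ i, σ i)
  simp only [ph_sub, ph_neg, ph_add]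
  field_simp

theorem yPt_relation (hP : Generic N P n) (hS : IsChoice N P S n) (hm : m + 2 ≤ n) (l : Fin m) :
    S.r1 (m + 2) * rtil S m * P.b (m + 1) * P.c (m + 1) *
      (∏ s ∈ Finset.Icc 1 (m - 1), S.y (m + 1) (l + 1) m s) *
      (∏ i ∈ Finset.univ.erase l, S.y (m + 1) (i + 1) (m + 1) (l + 1)) * S.r (m + 1) 0 *
      (yPt P S (m + 1) (l + 1) * S.yt (m + 1) (l + 1)) =
    S.r (m + 2) 0 * S.r1 (m + 1) * rtil S (m + 1) *
      (∏ k : Fin (m + 1), S.y (m + 2) (k + 1) (m + 1) (l + 1)) *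
      ∏ i ∈ Finset.univ.erase l, S.y (m + 1) (l + 1) (m + 1) (i + 1) := by
  have hl := l.2
  obtain ⟨j, rfl⟩ : ∃ j, m = j + 1 := ⟨m - 1, by omega⟩
  have h1 : ∏ s ∈ Finset.Icc 1 j, S.y (j + 2) (l + 1) (j + 1) s ≠ 0 :=
    Finset.prod_ne_zero_iff.mpr fun s hs => by
      simp only [Finset.mem_Icc] at hs
      exact (hP.regular_pPair hS (m := j + 1) (k := l + 1) hs.1 (by omega) (by omega) (by omega)
        (by omega)).2
  have h2 : ∏ i ∈ Finset.univ.erase l, S.y (j + 2) (i + 1) (j + 2) (l + 1) ≠ 0 :=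
    Finset.prod_ne_zero_iff.mpr fun i hi => by
      have := Finset.ne_of_mem_erase hi
      exact (hP.regular_pPair_same hS (by omega) (by omega) (by omega) (by omega) (by omega)
        (fun h => this (Fin.ext (by omega)))).2
  have h3 := hP.b_ne (j + 2) (by omega) (by omega)
  have h4 := hP.c_ne (j + 2) (by omega) (by omega)
  have h5 := hP.rtil_ne hS (m := j + 1) (by omega)
  have h6 := hP.r_ne_zero hS (m := j + 2) (s := 0) (by omega) (by omega)
  have h7 := hP.r1_ne hS (m := j + 3) (by omega) (by omega)
  have h8 : S.yt (j + 2) (l + 1) ≠ 0 :=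
    (hP.regular_pTilPair hS (by omega) (by omega) (by omega)).2
  simp only [yPt, Nat.add_sub_cancel, show j + 1 + 1 = j + 2 from rfl,
    show j + 1 + 2 = j + 3 from rfl,
    show j + 2 - 1 = j + 1 from rfl]
  rw [prod_Icc_eq_prod_fin (fun k => S.y (j + 3) k (j + 2) (l + 1)) (j + 2),
    prod_Icc_erase_eq_prod_fin (fun s => S.y (j + 2) (l + 1) (j + 2) s / S.y (j + 2) s (j + 2)
      (l + 1)) l, Finset.prod_div_distrib]
  generalize ∏ s ∈ Finset.Icc 1 j, S.y (j + 2) (l + 1) (j + 1) s = Y at *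
  generalize ∏ i ∈ Finset.univ.erase l, S.y (j + 2) (i + 1) (j + 2) (l + 1) = Z at *
  field_simp

/-- The algebra of `Q_node_coeff`. `L` is the node and `U`, `V` are the factors of `F`; `X`, `Y`,
`Z` are the products of `1 - ω ^ γ x` over the pairs with `ρ`, over the pairs within `σ`, and over
the latter in the opposite order. The relation that prescribes `y_{m+1,l}` enters as `e8` and
removes all `y`s. -/
theorem Q_node_coeff_aux {m : ℕ} {r1 phq phqr phr R r1' ω phS ph0 b c L U V Yp Eu Z X yk yil Y yli
    yP yt q r20 rt r10 : ℂ} (hω : ω ≠ 0) (h0 : ph0 ≠ 0) (hL : L ≠ 0) (hU : U ≠ 0) (hV : V ≠ 0)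
    (hEu : Eu ≠ 0) (hZ : Z ≠ 0) (hyk : yk ≠ 0) (hY : Y ≠ 0) (hyli : yli ≠ 0) (hr1 : r1' ≠ 0)
    (hr10 : r10 ≠ 0) (a2 : phq * phqr = phr) (e6 : rt * phS = r10 * ph0 * (-L * Eu))
    (e8 : r1 * R * b * c * Yp * yil * r10 * (yP * yt) = r20 * r1' * rt * yk * yli) :
    r1 * phq * (-(R / r1') * (ω * phS / ph0) * (b * c * L * U * V) * Yp / (ω * L * (Eu * Z)) *
      (phqr * (X / yk) * (yil / Y * (Z / yli)) * (yP / U * (yt / V)) * q)) =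
    r20 * phr * (L ^ (m + 1) * X) * q / (L ^ m * Y) := by
  have e : r1 * phq * (-(R / r1') * (ω * phS / ph0) * (b * c * L * U * V) * Yp /
      (ω * L * (Eu * Z)) *
      (phqr * (X / yk) * (yil / Y * (Z / yli)) * (yP / U * (yt / V)) * q)) =
      (r1 * R * b * c * Yp * yil * r10 * (yP * yt)) * (-phS * (phq * phqr) * X * q) /
        (r10 * r1' * ph0 * Eu * yk * Y * yli) := by
    have e' : r1 * phq * (-(R / r1') * (ω * phS / ph0) * (b * c * L * U * V) * Yp /
      (ω * L * (Eu * Z)) *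
      (phqr * (X / yk) * (yil / Y * (Z / yli)) * (yP / U * (yt / V)) * q)) =
      (r1 * R * b * c * Yp * yil * (yP * yt)) * (-phS * (phq * phqr) * X * q) /
        (r1' * ph0 * Eu * yk * Y * yli) * (ω / ω * (L / L) * (U / U) * (V / V) * (Z / Z)) := by
      ring
    rw [e', div_self hω, div_self hL, div_self hU, div_self hV, div_self hZ]
    rw [show r1 * R * b * c * Yp * yil * r10 * (yP * yt) * (-phS * (phq * phqr) * X * q) /
        (r10 * r1' * ph0 * Eu * yk * Y * yli) = r1 * R * b * c * Yp * yil * (yP * yt) *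
        (-phS * (phq * phqr) * X * q) / (r1' * ph0 * Eu * yk * Y * yli) * (r10 / r10) by ring,
      div_self hr10]
    ring
  rw [e, e8, a2]
  rw [show r20 * r1' * rt * yk * yli * (-phS * phr * X * q) =
    -(rt * phS) * (r20 * r1' * yk * yli * phr * X * q) by ring, e6]
  field_simp
  ring

/-- The eigenvalue equation of `B` at a zero of `beta S σ`, where the term with the old `B` drops
out. -/
theorem Q_node_coeff (hP : Generic N P n) (hS : IsChoice N P S n) (hm : m + 2 ≤ n)
    (l : Fin m) (σ : Fin (m + 1) → ZMod N) (q : ZMod N) (ρ : Fin (m + 2) → ZMod N) :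
    S.r1 (m + 2) * ph (-q) * (phi P S (lower σ l.succ) l.succ / (lam S (lower σ l.succ) l.succ *
      ∏ s ∈ Finset.univ.erase l, (lam S (lower σ l.succ) l.succ - lam S σ s.succ)) *
        Q P S m (lower σ l.succ) q ρ) =
    (S.r (m + 2) 0 * ph (-ρ 0) * (∏ k : Fin (m + 1), (lam S σ l.succ - lam S ρ k.succ)) *
      Q P S m σ q ρ) /
      (lam S σ l.succ * ∏ s ∈ Finset.univ.erase l, (lam S σ l.succ - lam S σ s.succ)) := by
  have hl := l.2
  have hr : ∀ i : Fin m, S.r (m + 1) (i + 1) ≠ 0 := fun i =>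
    hP.r_ne_zero hS (by omega) (by omega)
  have hp : ∀ k : Fin (m + 1), Regular N (pPair S (m + 2) (k + 1) (m + 1) (l + 1)) := fun k =>
    hP.regular_pPair hS (by omega) (by omega) (by omega) (by omega) hm
  have hs : ∀ i j : Fin m, i ≠ j → Regular N (pPair S (m + 1) (i + 1) (m + 1) (j + 1)) :=
    fun i j hij => hP.regular_pPair_same hS (by omega) (by omega) (by omega) (by omega) (by omega)
      (fun h => hij (Fin.ext (by omega)))
  have hw : Regular N (pPt P S (m + 1) (l + 1)) :=
    hP.regular_pPt hS (by omega) (by omega) (by omega)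
  have ht : Regular N (pTilPair P S (m + 1) (l + 1)) :=
    hP.regular_pTilPair hS (by omega) (by omega) (by omega)
  have hL : lam S σ l.succ ≠ 0 := lam_ne_zero (hr l)
  have e1 : ∀ k : Fin (m + 1), lam S σ l.succ - lam S ρ k.succ = lam S σ l.succ *
      (1 - ph (σ l.succ - ρ k.succ) * (S.r (m + 2) (k + 1) / S.r (m + 1) (l + 1))) :=
    fun k => lam_sub_lam_fst σ ρ l.succ k.succ (hr l)
  have e2 : ∀ i : Fin m, lam S σ l.succ - lam S σ i.succ = lam S σ l.succ *
      (1 - ph (σ l.succ - σ i.succ) * (S.r (m + 1) (i + 1) / S.r (m + 1) (l + 1))) :=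
    fun i => lam_sub_lam_fst σ σ l.succ i.succ (hr l)
  have e3 : ∀ i ∈ Finset.univ.erase l, om N * lam S σ l.succ - lam S σ i.succ =
      -lam S σ i.succ * (1 - ph (σ i.succ - σ l.succ + 1) *
        (S.r (m + 1) (l + 1) / S.r (m + 1) (i + 1))) := fun i hi => by
    have hil : i.succ ≠ l.succ := fun h => Finset.ne_of_mem_erase hi (Fin.succ_injective _ h)
    have := lam_sub_lam_snd σ (lower σ l.succ) i.succ l.succ (hr i)
    rw [lam_lower_same, lower_same] at this
    rw [this, sub_sub_eq_add_sub, add_sub_right_comm]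
    rfl
  have e4 : F N P (m + 1) (lam S σ l.succ) = P.b (m + 1) * P.c (m + 1) * lam S σ l.succ *
      (1 - ph (1 - σ l.succ) * (pPt P S (m + 1) (l + 1)).1) *
        (1 - ph (σ l.succ) * (pTilPair P S (m + 1) (l + 1)).1) := by
    rw [ph_sub, div_eq_mul_inv]
    exact F_eq _ _ (hP.b_ne _ (by omega) (by omega)) (hP.c_ne _ (by omega) (by omega))
      (hP.kap_ne _ (by omega) (by omega)) (hr l) (ph_ne_zero _) (by rw [← ph_neg]; rfl)
  -- Lowering multiplies the zero by `ω`, which the division by `ω` inside `phi` undoes: `F` is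
  -- evaluated at the original node.
  have e5 : phi P S (lower σ l.succ) l.succ = -(rtil S m / S.r1 (m + 1)) *
      ph (1 - ∑ i, σ i + σ 0) * F N P (m + 1) (lam S σ l.succ) *
        ∏ s ∈ Finset.Icc 1 (m - 1), S.y (m + 1) (l + 1) m s := by
    rw [phi, sum_lower, lower_of_ne _ (Fin.succ_ne_zero l).symm, lam_lower_same,
      mul_div_cancel_left₀ _ om_ne_zero, neg_sub]
    rfl
  have e6 : rtil S (m + 1) * ph (-∑ i, σ i) = S.r (m + 1) 0 * ph (-σ 0) *
      (-lam S σ l.succ * ∏ k ∈ Finset.univ.erase l, -lam S σ k.succ) := by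
    rw [rtil_mul_ph, Finset.mul_prod_erase _ (fun k : Fin m => -lam S σ k.succ)
      (Finset.mem_univ l)]
  have e7 : lam S σ l.succ * ∏ i ∈ Finset.univ.erase l, lam S σ l.succ = lam S σ l.succ ^ m := by
    rw [Finset.mul_prod_erase _ (fun _ => lam S σ l.succ) (Finset.mem_univ l)]
    simp
  have e8 := yPt_relation hP hS hm l
  have n1 : ∏ i ∈ Finset.univ.erase l,
      (1 - ph (σ l.succ - σ i.succ) * (S.r (m + 1) (i + 1) / S.r (m + 1) (l + 1))) ≠ 0 :=
    Finset.prod_ne_zero_iff.mpr fun i hi =>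
      one_sub_ph_ne (hs i l (Finset.ne_of_mem_erase hi)) _
  have n2 : ∏ i ∈ Finset.univ.erase l, (1 - ph (σ i.succ - σ l.succ + 1) *
        (S.r (m + 1) (l + 1) / S.r (m + 1) (i + 1))) ≠ 0 :=
    Finset.prod_ne_zero_iff.mpr fun i hi =>
      one_sub_ph_ne (hs l i (Finset.ne_of_mem_erase hi).symm) _
  have n3 : ∏ i ∈ Finset.univ.erase l, S.y (m + 1) (l + 1) (m + 1) (i + 1) ≠ 0 :=
    Finset.prod_ne_zero_iff.mpr fun i hi => (hs l i (Finset.ne_of_mem_erase hi).symm).2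
  have n4 : ∏ k : Fin (m + 1), S.y (m + 2) (k + 1) (m + 1) (l + 1) ≠ 0 :=
    Finset.prod_ne_zero_iff.mpr fun k _ => (hp k).2
  have n5 : ∏ k ∈ Finset.univ.erase l, -lam S σ k.succ ≠ 0 :=
    Finset.prod_ne_zero_iff.mpr fun k _ => neg_ne_zero.mpr (lam_ne_zero (hr k))
  have n6 := one_sub_ph_ne hw (1 - σ l.succ)
  have n7 := one_sub_ph_ne ht (σ l.succ)
  have n8 := hP.r1_ne hS (m := m + 1) (by omega) (by omega)
  have n9 := hP.r_zero_ne hS (m := m + 1) (by omega) (by omega)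
  have hω := om_ne_zero (N := N)
  have eyp : (pPt P S (m + 1) (l + 1)).2 = yPt P S (m + 1) (l + 1) := rfl
  rw [Q_lower_succ l hp hs hw ht, e5, e4, lam_lower_same, Finset.prod_congr rfl e3]
  simp only [e1, e2, Finset.prod_mul_distrib, Finset.prod_div_distrib, eyp]
  rw [← mul_assoc (lam S σ l.succ) (∏ i ∈ Finset.univ.erase l, lam S σ l.succ), e7,
    Finset.prod_const, Finset.card_univ, Fintype.card_fin]
  have a1 : ph (1 - ∑ i, σ i + σ 0) = om N * ph (-∑ i, σ i) / ph (-σ 0) := by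
    rw [ph_add, sub_eq_add_neg, ph_add, ph_neg (σ 0), div_inv_eq_mul, om]
  have a2 : ph (-q) * ph (q - ρ 0) = ph (-ρ 0) := by
    rw [← ph_add]; congr 1; ring
  have a3 := ph_ne_zero (-σ 0)
  rw [a1]
  exact Q_node_coeff_aux hω a3 hL n6 n7 n5 n2 n4 n1 n3 n8 n9 a2 e6 e8

end Identities

section Chain

variable {N : ℕ} [NeZero N] {P : Params} {S : Choice} {n m : ℕ}

/-! ### Combinations of the vectors `Ψ_σ ⊗ ψ_q` -/

/-- The vector `∑ c(σ, q) Ψ_σ ⊗ ψ_q` of the chain with `m + 2` sites. -/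
def comb (P : Params) (S : Choice) (m : ℕ) :
    ((Fin (m + 1) → ZMod N) → ZMod N → ℂ) →ₗ[ℂ] State N (m + 2) where
  toFun c := ∑ σ, ∑ q, c σ q • tens (Psi P S m σ) (psi P S (m + 2) q)
  map_add' c c' := by simp [add_smul, Finset.sum_add_distrib]
  map_smul' a c := by simp [mul_smul, Finset.smul_sum]

theorem comb_apply (c : (Fin (m + 1) → ZMod N) → ZMod N → ℂ) :
    comb P S m c = ∑ σ, ∑ q, c σ q • tens (Psi P S m σ) (psi P S (m + 2) q) := rfl

theorem Psi_succ (ρ : Fin (m + 2) → ZMod N) :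
    Psi P S (m + 1) ρ = comb P S m fun σ q => Q P S m σ q ρ := rfl

/-- The tensor product with a fixed vector of the last site. -/
def tensRight (g : ZMod N → ℂ) : State N n →ₗ[ℂ] State N (n + 1) where
  toFun f := tens f g
  map_add' f f' := by funext γ; simp [tens, add_mul]
  map_smul' a f := by funext γ; simp [tens, mul_assoc]

theorem sum_smul_raise (d : (Fin (m + 1) → ZMod N) → ZMod N → ℂ) (k : Fin (m + 1)) :
    ∑ σ, ∑ q, d σ q • tens (Psi P S m (raise σ k)) (psi P S (m + 2) q) =
      comb P S m fun σ q => d (lower σ k) q := by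
  refine Fintype.sum_equiv ⟨fun σ => raise σ k, fun σ => lower σ k, fun σ => lower_raise σ k,
    fun σ => raise_lower σ k⟩ _ _ fun σ => ?_
  simp only [Equiv.coe_fn_mk, lower_raise]

theorem vOp_comb (c : (Fin (m + 1) → ZMod N) → ZMod N → ℂ) :
    vOp (Fin.last (m + 1)) (comb P S m c) = comb P S m fun σ q => c σ (q - 1) := by
  simp only [comb_apply, map_sum, map_smul, vOp_last_tens, psi_sub_one]
  refine Finset.sum_congr rfl fun σ _ => ?_
  exact Fintype.sum_equiv (Equiv.addRight 1) _ _ fun q => by simp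

theorem uInv_comb (ha : P.a (m + 2) ≠ 0) (hp : Regular N (pSite P S (m + 2)))
    (c : (Fin (m + 1) → ZMod N) → ZMod N → ℂ) :
    uInv (Fin.last (m + 1)) (P.a (m + 2) • comb P S m c -
      P.b (m + 2) • vOp (Fin.last (m + 1)) (comb P S m c)) =
      comb P S m fun σ q => S.r1 (m + 2) * ph (-q) * c σ q := by
  have h : ∀ (f : State N (m + 1)) (q : ZMod N), uInv (Fin.last (m + 1))
      (P.a (m + 2) • tens f (psi P S (m + 2) q) -
        P.b (m + 2) • tens f (psi P S (m + 2) (q + 1))) =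
      (S.r1 (m + 2) * ph (-q)) • tens f (psi P S (m + 2) q) := fun f q => by
    funext γ
    have := psi_eigen P S ha hp q (γ (Fin.last (m + 1)))
    simp only [map_sub, map_smul, uInv_last_tens, Pi.sub_apply, Pi.smul_apply, smul_eq_mul, tens]
    linear_combination f (Fin.init γ) * this
  simp only [comb_apply, map_sum, map_smul, vOp_last_tens, psi_sub_one, Finset.smul_sum,
    ← Finset.sum_sub_distrib]
  refine Finset.sum_congr rfl fun σ _ => Finset.sum_congr rfl fun q _ => ?_
  rw [smul_comm (P.a (m + 2)), smul_comm (P.b (m + 2)), ← smul_sub, map_smul, h, smul_smul,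
    mul_comm]

/-- As `u⁻¹ (a - b v)` is diagonal and invertible on the combinations, any `f` is `u⁻¹ (a - b v) g`
for an explicit `g`, and then `u f = (a - b v) g`. -/
theorem uOp_comb (ha : P.a (m + 2) ≠ 0) (hr : S.r1 (m + 2) ≠ 0)
    (hp : Regular N (pSite P S (m + 2))) (c : (Fin (m + 1) → ZMod N) → ZMod N → ℂ) :
    uOp (Fin.last (m + 1)) (comb P S m c) = comb P S m fun σ q =>
      P.a (m + 2) * (ph q / S.r1 (m + 2) * c σ q) -
        P.b (m + 2) * (ph (q - 1) / S.r1 (m + 2) * c σ (q - 1)) := by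
  have h := uInv_comb ha hp (fun σ q => ph q / S.r1 (m + 2) * c σ q)
  have e : (fun σ q => S.r1 (m + 2) * ph (-q) * (ph q / S.r1 (m + 2) * c σ q)) = c := by
    funext σ q
    have := ph_ne_zero q
    rw [ph_neg]
    field_simp
  rw [e] at h
  rw [← h, ← Module.End.mul_apply, uOp_mul_uInv, Module.End.one_apply, vOp_comb, ← map_smul,
    ← map_smul, ← map_sub]
  rfl

/-- Freezing the last coordinate reduces to independence on the first sites; letting it vary then
uses independence on the last site. -/
theorem comb_injective (hΨ : LinearIndependent ℂ (Psi (N := N) P S m))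
    (hψ : LinearIndependent ℂ (psi (N := N) P S (m + 2)))
    {c : (Fin (m + 1) → ZMod N) → ZMod N → ℂ} (h : comb P S m c = 0) : c = 0 := by
  rw [Fintype.linearIndependent_iff] at hΨ hψ
  have h1 : ∀ γ' σ, ∑ q, c σ q * psi P S (m + 2) q γ' = 0 := fun γ' => by
    refine hΨ (fun σ => ∑ q, c σ q * psi P S (m + 2) q γ') ?_
    funext γ
    have := congrFun h (Fin.snoc (α := fun _ => ZMod N) γ γ')
    simp only [comb_apply, Finset.sum_apply, Pi.smul_apply, tens, Fin.init_snoc, Fin.snoc_last,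
      smul_eq_mul, Pi.zero_apply] at this
    simp only [Finset.sum_apply, Pi.smul_apply, smul_eq_mul, Pi.zero_apply, Finset.sum_mul]
    rw [← this]
    refine Finset.sum_congr rfl fun σ _ => Finset.sum_congr rfl fun q _ => by ring
  funext σ q
  refine hψ (c σ) ?_ q
  funext γ'
  simpa using h1 γ' σ

theorem ph_injective : Function.Injective (ph : ZMod N → ℂ) :=
  ZMod.injective_stdAddChar

/-- The operator `u⁻¹ (a - b v)` of a single site. -/
def siteOp (N : ℕ) [NeZero N] (a b : ℂ) : Module.End ℂ (ZMod N → ℂ) where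
  toFun g := fun γ => ph (-γ) * (a * g γ - b * g (γ - 1))
  map_add' f g := by funext γ; simp; ring
  map_smul' c f := by funext γ; simp; ring

theorem psi_ne_zero (k : ℕ) (q : ZMod N) : psi P S k q ≠ 0 := fun h => by
  have := congrFun h q
  simp [psi, w_zero] at this

theorem linearIndependent_psi {k : ℕ} (ha : P.a k ≠ 0) (hr : S.r1 k ≠ 0)
    (hp : Regular N (pSite P S k)) : LinearIndependent ℂ (psi (N := N) P S k) := by
  refine Module.End.eigenvectors_linearIndependent' (siteOp N (P.a k) (P.b k))
    (fun q => S.r1 k * ph (-q)) (fun q q' h => ?_) _ fun q => ⟨?_, psi_ne_zero k q⟩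
  · exact neg_injective (ph_injective (mul_left_cancel₀ hr h))
  · rw [Module.End.mem_eigenspace_iff]
    funext γ
    have h1 := psi_eigen P S ha hp q γ
    rw [← congrFun (psi_sub_one P S k q) γ] at h1
    exact h1

/-! ### The eigenvalues of `B` separate the labels -/

/-- `N`-th powers forget the phase and separate the indices; the phase then separates the labels. -/
theorem lam_injective (hP : Generic N P n) (hS : IsChoice N P S n) (hm : m + 1 ≤ n)
    (ρ ρ' : Fin (m + 1) → ZMod N) {k k' : Fin m} (h : lam S ρ k.succ = lam S ρ' k'.succ) :
    k = k' ∧ ρ k.succ = ρ' k'.succ := by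
  have hk : k = k' := by
    by_contra hne
    have h1 := congrArg (· ^ N) h
    simp only [lam_pow] at h1
    exact hP.r_pow_ne hS (by simp) k.succ.2 (by simp) k'.succ.2 hm
      (fun h2 => hne (Fin.succ_injective _ (Fin.ext h2)))
      (mul_left_cancel₀ (pow_ne_zero N (by norm_num)) h1)
  subst hk
  refine ⟨rfl, ?_⟩
  simp only [lam, neg_inj] at h
  exact neg_injective (ph_injective (mul_left_cancel₀ (hP.r_ne_zero hS k.succ.2 hm) h))

/-- The eigenvalue of `B` as a polynomial in the spectral parameter. -/
def betaPoly (S : Choice) (σ : Fin (m + 1) → ZMod N) : ℂ[X] :=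
  C (S.r (m + 1) 0 * ph (-σ 0)) * (X * ∏ k : Fin m, (X - C (lam S σ k.succ)))

theorem eval_betaPoly (σ : Fin (m + 1) → ZMod N) (z : ℂ) :
    (betaPoly S σ).eval z = beta S σ z := by
  rw [beta_eq, betaPoly]
  simp only [eval_mul, eval_C, eval_X, eval_prod, eval_sub]
  ring

theorem natDegree_betaPoly_le (σ : Fin (m + 1) → ZMod N) : (betaPoly S σ).natDegree ≤ m + 1 := by
  refine (natDegree_C_mul_le _ _).trans (natDegree_mul_le.trans ?_)
  rw [natDegree_prod_X_sub Finset.univ (fun k : Fin m => lam S σ k.succ), natDegree_X,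
    Finset.card_fin, add_comm]

theorem coeff_betaPoly (σ : Fin (m + 1) → ZMod N) :
    (betaPoly S σ).coeff (m + 1) = S.r (m + 1) 0 * ph (-σ 0) := by
  rw [betaPoly, coeff_C_mul, coeff_X_mul, coeff_prod_X_sub fun k : Fin m => lam S σ k.succ,
    mul_one]

/-- The leading coefficient determines `σ 0`, and the nonzero roots determine the other components.
-/
theorem betaPoly_injective (hP : Generic N P n) (hS : IsChoice N P S n) (hm : m + 1 ≤ n) :
    Function.Injective (betaPoly S : (Fin (m + 1) → ZMod N) → ℂ[X]) := fun σ σ' h => by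
  have hr := hP.r_zero_ne hS (m := m + 1) (by omega) hm
  have h0 := coeff_betaPoly (S := S) σ
  rw [h, coeff_betaPoly] at h0
  have h1 : σ 0 = σ' 0 := (neg_injective (ph_injective (mul_left_cancel₀ hr h0))).symm
  funext i
  refine Fin.cases h1 (fun k => ?_) i
  have h2 := congrArg (eval (lam S σ k.succ)) h
  rw [eval_betaPoly, eval_betaPoly, beta_eq, beta_eq,
    Finset.prod_eq_zero (Finset.mem_univ k) (sub_self _), mul_zero] at h2
  have h3 := (mul_eq_zero.mp h2.symm).resolve_left (mul_ne_zero
    (lam_ne_zero (hP.r_ne_zero hS k.succ.2 hm)) (mul_ne_zero hr (ph_ne_zero _)))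
  obtain ⟨j, -, hj⟩ := Finset.prod_eq_zero_iff.mp h3
  obtain ⟨rfl, h4⟩ := lam_injective hP hS hm σ σ' (sub_eq_zero.mp hj)
  exact h4

/-- Any `z` that is not a root of the product of all pairwise differences works. It supplies one
operator `B (z)` with distinct eigenvalues on all labels. -/
theorem exists_eval_injective {ι : Type*} [Finite ι] {p : ι → ℂ[X]} (hp : Function.Injective p) :
    ∃ z, Function.Injective fun i => (p i).eval z := by
  classical
  have := Fintype.ofFinite ι
  have h : ∏ x : ι × ι, (if x.1 = x.2 then 1 else p x.1 - p x.2) ≠ 0 :=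
    Finset.prod_ne_zero_iff.mpr fun x _ => by
      split_ifs with hx
      · exact one_ne_zero
      · exact sub_ne_zero.mpr fun h => hx (hp h)
  obtain ⟨z, hz⟩ : ∃ z, eval z (∏ x : ι × ι, (if x.1 = x.2 then 1 else p x.1 - p x.2)) ≠ 0 := by
    by_contra hcon
    push Not at hcon
    exact h (Polynomial.funext fun z => by rw [hcon z, eval_zero])
  refine ⟨z, fun i j hij => ?_⟩
  by_contra hne
  rw [eval_prod] at hz
  refine Finset.prod_ne_zero_iff.mp hz (i, j) (Finset.mem_univ _) ?_
  simp only [if_neg hne, eval_sub]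
  exact sub_eq_zero.mpr hij

theorem linearIndependent_Psi (hP : Generic N P n) (hS : IsChoice N P S n) (hm : m + 1 ≤ n)
    (hB : ∀ (σ : Fin (m + 1) → ZMod N) z,
      Module.End.HasEigenvector (B P (m + 1) z) (beta S σ z) (Psi P S m σ)) :
    LinearIndependent ℂ (Psi (N := N) P S m) := by
  obtain ⟨z, hz⟩ := exists_eval_injective (betaPoly_injective (N := N) (m := m) hP hS hm)
  simp only [eval_betaPoly] at hz
  exact Module.End.eigenvectors_linearIndependent' _ _ hz _ fun σ => hB σ z

theorem Q_ne_zero (hP : Generic N P n) (hS : IsChoice N P S n) (hm : m + 2 ≤ n)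
    (σ : Fin (m + 1) → ZMod N) (q : ZMod N) (ρ : Fin (m + 2) → ZMod N) : Q P S m σ q ρ ≠ 0 := by
  refine mul_ne_zero (mul_ne_zero (div_ne_zero (ph_ne_zero _) (mul_ne_zero
    (w_ne_zero (hP.regular_pZero hS hm) _) (w_ne_zero (hP.regular_pTil hS hm) _)))
    (div_ne_zero (Finset.prod_ne_zero_iff.mpr fun l _ => Finset.prod_ne_zero_iff.mpr fun k _ =>
      w_ne_zero (hP.regular_pPair hS (by omega) (by omega) (by omega) (by omega) hm) _)
    (Finset.prod_ne_zero_iff.mpr fun j _ => Finset.prod_ne_zero_iff.mpr fun l hl => w_ne_zero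
      (hP.regular_pPair_same hS (by omega) (by omega) (by omega) (by omega) (by omega) fun h =>
        Finset.ne_of_mem_erase hl (Fin.ext (by omega))) _)))
    (Finset.prod_ne_zero_iff.mpr fun l _ => div_ne_zero
      (w_ne_zero (hP.regular_pPt hS (by omega) (by omega) (by omega)) _)
      (w_ne_zero (hP.regular_pTilPair hS (by omega) (by omega) (by omega)) _))

/-! ### The induction over the length of the chain -/

/-- The formula for the action of `A` on the vectors `Ψ` of the chain with `m + 1` sites. -/
def ActionA (N : ℕ) [NeZero N] (P : Params) (S : Choice) (m : ℕ) : Prop :=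
  ∀ (ρ : Fin (m + 1) → ZMod N) (z : ℂ), A P (m + 1) z (Psi P S m ρ) =
    (∏ s : Fin m, (1 - z / lam S ρ s.succ)) • Psi P S m ρ +
    (z * (∏ j ∈ Finset.Icc 1 (m + 1), P.kap j) * ∏ s : Fin m, (z - lam S ρ s.succ)) •
      Psi P S m (raise ρ 0) +
    ∑ k : Fin m,
      ((∏ s ∈ Finset.univ.erase k,
          (z - lam S ρ s.succ) / (lam S ρ k.succ - lam S ρ s.succ)) *
        (z / lam S ρ k.succ) * phi P S ρ k.succ) • Psi P S m (raise ρ k.succ)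

/-- The coefficients of `A (X) ∑ c(σ, q) Ψ_σ ⊗ ψ_q` for the operator `A` of the first `m + 1`
sites. -/
def coefA (P : Params) (S : Choice) (c : (Fin (m + 1) → ZMod N) → ZMod N → ℂ)
    (σ : Fin (m + 1) → ZMod N) (q : ZMod N) : ℂ[X] :=
  interp (fun s : Fin m => lam S σ s.succ) (c σ q)
    ((∏ j ∈ Finset.Icc 1 (m + 1), P.kap j) * c (lower σ 0) q)
    fun l => phi P S (lower σ l.succ) l.succ / (lam S (lower σ l.succ) l.succ *
      ∏ s ∈ Finset.univ.erase l, (lam S (lower σ l.succ) l.succ - lam S σ s.succ)) *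
        c (lower σ l.succ) q

/-- Reindexing the sums moves the label shifts from the vectors to the coefficients. Lowering `σ 0`
moves no node and lowering another component moves only its own, so the interpolation polynomials
have the nodes of `σ`. -/
theorem liftHom_A_comb (hA : ActionA N P S m) (c : (Fin (m + 1) → ZMod N) → ZMod N → ℂ) (z : ℂ) :
    liftHom N (m + 1) (A P (m + 1) z) (comb P S m c) =
      comb P S m fun σ q => (coefA P S c σ q).eval z := by
  have ht : ∀ (f : State N (m + 1)) (g : ZMod N → ℂ), tens f g = tensRight g f := fun _ _ => rfl
  simp only [comb_apply c, map_sum, map_smul, liftHom_tens]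
  simp only [hA _ z, ht, map_add, map_sum, map_smul, smul_add, Finset.smul_sum, smul_smul,
    Finset.sum_add_distrib]
  have hswap : ∀ f : (Fin (m + 1) → ZMod N) → ZMod N → Fin m → State N (m + 2),
      ∑ σ, ∑ q, ∑ k, f σ q k = ∑ k, ∑ σ, ∑ q, f σ q k := fun f => by
    rw [Finset.sum_congr rfl fun σ _ => Finset.sum_comm, Finset.sum_comm]
  rw [hswap]
  simp only [← ht, sum_smul_raise]
  rw [← comb_apply fun σ q => c σ q * ∏ s : Fin m, (1 - z / lam S σ s.succ), ← map_add, ← map_sum,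
    ← map_add]
  congr 1
  funext σ q
  simp only [Pi.add_apply, Finset.sum_apply, coefA, eval_interp]
  have h0 : ∀ s : Fin m, lam S (lower σ 0) s.succ = lam S σ s.succ := fun s =>
    lam_lower_of_ne _ (Fin.succ_ne_zero s)
  simp only [h0]
  congr 1
  · ring
  · refine Finset.sum_congr rfl fun k _ => ?_
    have h1 : ∀ s ∈ Finset.univ.erase k, (z - lam S (lower σ k.succ) s.succ) /
        (lam S (lower σ k.succ) k.succ - lam S (lower σ k.succ) s.succ) =
        (z - lam S σ s.succ) / (lam S (lower σ k.succ) k.succ - lam S σ s.succ) := fun s hs => by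
      rw [lam_lower_of_ne (k := s.succ) _ fun h =>
        Finset.ne_of_mem_erase hs (Fin.succ_injective _ h)]
    rw [Finset.prod_congr rfl h1, Finset.prod_div_distrib]
    ring

theorem liftHom_B_comb (hB : ∀ (σ : Fin (m + 1) → ZMod N) z,
      Module.End.HasEigenvector (B P (m + 1) z) (beta S σ z) (Psi P S m σ))
    (c : (Fin (m + 1) → ZMod N) → ZMod N → ℂ) (z : ℂ) :
    liftHom N (m + 1) (B P (m + 1) z) (comb P S m c) =
      comb P S m fun σ q => beta S σ z * c σ q := by
  have ht : ∀ (f : State N (m + 1)) (g : ZMod N → ℂ), tens f g = tensRight g f := fun _ _ => rfl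
  simp only [comb_apply, map_sum, map_smul, liftHom_tens, (hB _ z).apply_eq_smul]
  refine Finset.sum_congr rfl fun σ _ => Finset.sum_congr rfl fun q _ => ?_
  rw [ht, map_smul, smul_smul, mul_comm, ht]

theorem coefA_sub_one (c : (Fin (m + 1) → ZMod N) → ZMod N → ℂ) (σ : Fin (m + 1) → ZMod N)
    (q : ZMod N) : coefA P S (fun σ q => c σ (q - 1)) σ q = coefA P S c σ (q - 1) := rfl

theorem eval_coefA_mul (f : ZMod N → ℂ) (c : (Fin (m + 1) → ZMod N) → ZMod N → ℂ)
    (σ : Fin (m + 1) → ZMod N) (q : ZMod N) (z : ℂ) :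
    (coefA P S (fun σ q => f q * c σ q) σ q).eval z = f q * (coefA P S c σ q).eval z := by
  simp only [coefA, eval_interp, mul_add, Finset.mul_sum]
  congr 1
  · ring
  · exact Finset.sum_congr rfl fun l _ => by ring

theorem eval_coefA_zero (c : (Fin (m + 1) → ZMod N) → ZMod N → ℂ) (σ : Fin (m + 1) → ZMod N)
    (q : ZMod N) : (coefA P S c σ q).eval 0 = c σ q := by
  simp [coefA, eval_interp]

/-- The coefficient form of the eigenvalue equation of the longer `B`. The right-hand side divided
by `z` is interpolated at the nodes of `σ`; its three kinds of terms match `Q_const_coeff`,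
`Q_top_coeff` and `Q_node_coeff`. -/
theorem coefA_beta_identity (hP : Generic N P n) (hS : IsChoice N P S n) (hm : m + 2 ≤ n)
    (ρ : Fin (m + 2) → ZMod N) (σ : Fin (m + 1) → ZMod N) (q : ZMod N) (z : ℂ) :
    z * (S.r1 (m + 2) * ph (-q)) * (coefA P S (fun σ q => Q P S m σ q ρ) σ q).eval z +
      beta S σ z * (z * P.a (m + 2) * P.c (m + 2) * Q P S m σ q ρ +
        P.b (m + 2) * P.d (m + 2) / P.kap (m + 2) * Q P S m σ (q - 1) ρ) =
    beta S ρ z * Q P S m σ q ρ := by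
  have hν : ∀ s : Fin m, lam S σ s.succ ≠ 0 := fun s =>
    lam_ne_zero (hP.r_ne_zero hS s.succ.2 (by omega))
  have hinj : Function.Injective fun s : Fin m => lam S σ s.succ := fun s t h =>
    (lam_injective hP hS (by omega) σ σ h).1
  have hdeg : (C (S.r (m + 2) 0 * ph (-ρ 0) * Q P S m σ q ρ) *
      ∏ k : Fin (m + 1), (X - C (lam S ρ k.succ))).natDegree ≤ m + 1 :=
    (natDegree_C_mul_le _ _).trans (by
      rw [natDegree_prod_X_sub Finset.univ (fun k : Fin (m + 1) => lam S ρ k.succ),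
        Finset.card_fin])
  have hI := congrArg (eval z) (eq_interp hν hinj hdeg)
  rw [coeff_C_mul, coeff_prod_X_sub fun k : Fin (m + 1) => lam S ρ k.succ, eval_interp] at hI
  simp only [eval_mul, eval_C, eval_prod, eval_sub, eval_X, zero_sub, mul_one] at hI
  -- Only the `b d / ϰ` part of the `beta` term is rewritten in this way, to join the constant-term
  -- part of the interpolation; the `a c` part already belongs to the leading coefficient.
  have hprod : ∏ s : Fin m, (z - lam S σ s.succ) =
      (∏ s : Fin m, -lam S σ s.succ) * ∏ s : Fin m, (1 - z / lam S σ s.succ) := by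
    rw [← Finset.prod_mul_distrib]
    refine Finset.prod_congr rfl fun s _ => ?_
    have := hν s
    field_simp
    ring
  have h0 := Q_const_coeff hP hS hm σ q ρ
  have h1 := Q_top_coeff hP hS hm σ q ρ
  have h2 : ∑ l : Fin m, S.r1 (m + 2) * ph (-q) * (phi P S (lower σ l.succ) l.succ /
      (lam S (lower σ l.succ) l.succ *
        ∏ s ∈ Finset.univ.erase l, (lam S (lower σ l.succ) l.succ - lam S σ s.succ)) *
        Q P S m (lower σ l.succ) q ρ) * (z * ∏ s ∈ Finset.univ.erase l, (z - lam S σ s.succ)) =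
      ∑ l : Fin m, S.r (m + 2) 0 * ph (-ρ 0) * Q P S m σ q ρ *
        (∏ k : Fin (m + 1), (lam S σ l.succ - lam S ρ k.succ)) /
      (lam S σ l.succ * ∏ s ∈ Finset.univ.erase l, (lam S σ l.succ - lam S σ s.succ)) *
        (z * ∏ s ∈ Finset.univ.erase l, (z - lam S σ s.succ)) :=
    Finset.sum_congr rfl fun l _ => by
      rw [Q_node_coeff hP hS hm l σ q ρ, mul_right_comm (S.r (m + 2) 0 * ph (-ρ 0))]
  simp only [mul_assoc (S.r1 (m + 2) * ph (-q))] at h2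
  rw [← Finset.mul_sum] at h2
  rw [← h2] at hI
  rw [beta_eq σ, beta_eq ρ, coefA, eval_interp]
  have hprod' := congrArg (fun x => z * (S.r (m + 1) 0 * ph (-σ 0)) *
    (P.b (m + 2) * P.d (m + 2) / P.kap (m + 2) * Q P S m σ (q - 1) ρ) * x) hprod
  linear_combination (-z) * hI + hprod' + z * (∏ s : Fin m, (1 - z / lam S σ s.succ)) * h0 +
    z * (z * ∏ s : Fin m, (z - lam S σ s.succ)) * h1

/-- At a zero of the eigenvalue of `B`, the operator `A` shifts the label. -/
theorem coefA_node (hP : Generic N P n) (hS : IsChoice N P S n) (hm : m + 2 ≤ n)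
    (ρ : Fin (m + 2) → ZMod N) (σ : Fin (m + 1) → ZMod N) (q : ZMod N) {ν : ℂ} (hν : ν ≠ 0)
    (h0 : beta S ρ ν = 0) :
    (coefA P S (fun σ q => Q P S m σ q ρ) σ q).eval ν +
      P.kap (m + 2) * (ν * (coefA P S (fun σ q => Q P S m σ q ρ) σ (q - 1)).eval ν) +
      beta S σ ν * (P.a (m + 2) * (ph q / S.r1 (m + 2) *
          (P.c (m + 2) * Q P S m σ q ρ - P.d (m + 2) * Q P S m σ (q - 1) ρ)) -
        P.b (m + 2) * (ph (q - 1) / S.r1 (m + 2) *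
          (P.c (m + 2) * Q P S m σ (q - 1) ρ - P.d (m + 2) * Q P S m σ (q - 1 - 1) ρ))) =
    -(beta S σ ν) * ph q / (S.r1 (m + 2) * ν) * F N P (m + 2) (ν / om N) *
      Q P S m σ (q - 1) ρ := by
  have g0 := coefA_beta_identity hP hS hm ρ σ q ν
  have g1 := coefA_beta_identity hP hS hm ρ σ (q - 1) ν
  rw [h0, zero_mul] at g0 g1
  have hr1 := hP.r1_ne hS (m := m + 2) (by omega) hm
  have hk := hP.kap_ne (m + 2) (by omega) hm
  have hω := om_ne_zero (N := N)
  have hq := ph_ne_zero q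
  have hb1 : ph (q - 1) = ph q / om N := ph_sub q 1
  rw [ph_neg] at g0 g1
  rw [hb1] at g1 ⊢
  -- Because the eigenvalue for `ρ` vanishes at `ν`, the identities for `q` and `q - 1` can be
  -- solved for the values of `coefA`. After substitution the terms in `Q` at `q` and at `q - 2`
  -- cancel, and those at `q - 1` assemble to `F`.
  have k0 : (coefA P S (fun σ q => Q P S m σ q ρ) σ q).eval ν = -(beta S σ ν) * ph q /
      (S.r1 (m + 2) * ν) * (ν * P.a (m + 2) * P.c (m + 2) * Q P S m σ q ρ +
        P.b (m + 2) * P.d (m + 2) / P.kap (m + 2) * Q P S m σ (q - 1) ρ) := by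
    field_simp at g0 ⊢
    linear_combination g0
  have k1 : (coefA P S (fun σ q => Q P S m σ q ρ) σ (q - 1)).eval ν = -(beta S σ ν) *
      (ph q / om N) / (S.r1 (m + 2) * ν) *
      (ν * P.a (m + 2) * P.c (m + 2) * Q P S m σ (q - 1) ρ +
        P.b (m + 2) * P.d (m + 2) / P.kap (m + 2) * Q P S m σ (q - 1 - 1) ρ) := by
    field_simp at g1 ⊢
    linear_combination g1
  rw [k0, k1, F]
  field_simp
  ring

theorem B_Psi_succ (hP : Generic N P n) (hS : IsChoice N P S n) (hm : m + 2 ≤ n)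
    (hA : ActionA N P S m) (hB : ∀ (σ : Fin (m + 1) → ZMod N) z,
      Module.End.HasEigenvector (B P (m + 1) z) (beta S σ z) (Psi P S m σ))
    (ρ : Fin (m + 2) → ZMod N) (z : ℂ) :
    B P (m + 2) z (Psi P S (m + 1) ρ) = beta S ρ z • Psi P S (m + 1) ρ := by
  rw [Psi_succ, B_succ_apply, uInv_comb (hP.a_ne _ (by omega) hm)
    (hP.regular_pSite hS (by omega) hm), vOp_comb, ← map_smul, ← map_smul, ← map_smul, ← map_add,
    liftHom_B_comb hB, liftHom_A_comb hA, ← map_add, ← map_smul]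
  congr 1
  funext σ q
  have e : (z • fun (σ : Fin (m + 1) → ZMod N) q => S.r1 (m + 2) * ph (-q) * Q P S m σ q ρ) =
      fun σ q => (z * (S.r1 (m + 2) * ph (-q))) * Q P S m σ q ρ := by
    funext σ q
    simp only [Pi.smul_apply, smul_eq_mul, mul_assoc]
  rw [Pi.smul_apply, Pi.smul_apply, smul_eq_mul, ← coefA_beta_identity hP hS hm ρ σ q z, e]
  simp only [Pi.add_apply, Pi.smul_apply, smul_eq_mul]
  rw [eval_coefA_mul fun q => z * (S.r1 (m + 2) * ph (-q))]

theorem A_Psi_succ (hP : Generic N P n) (hS : IsChoice N P S n) (hm : m + 2 ≤ n)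
    (hA : ActionA N P S m) (hB : ∀ (σ : Fin (m + 1) → ZMod N) z,
      Module.End.HasEigenvector (B P (m + 1) z) (beta S σ z) (Psi P S m σ)) :
    ActionA N P S (m + 1) := by
  intro ρ z
  have hν : ∀ s : Fin (m + 1), lam S ρ s.succ ≠ 0 := fun s =>
    lam_ne_zero (hP.r_ne_zero hS s.succ.2 hm)
  have hinj : Function.Injective fun s : Fin (m + 1) => lam S ρ s.succ := fun s t h =>
    (lam_injective hP hS hm ρ ρ h).1
  have hr1 := hP.r1_ne hS (m := m + 2) (by omega) hm
  have hk := hP.kap_ne (m + 2) (by omega) hm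
  simp only [Psi_succ]
  rw [A_succ_apply, vOp_comb, ← map_smul, ← map_smul, ← map_smul, ← map_add, ← map_sub,
    uOp_comb (hP.a_ne _ (by omega) hm) hr1 (hP.regular_pSite hS (by omega) hm),
    liftHom_B_comb hB, map_add, map_add, map_smul, map_smul, liftHom_A_comb hA, liftHom_A_comb hA]
  simp only [← map_smul, ← map_add, ← map_sum]
  congr 1
  funext σ q
  simp only [Pi.add_apply, Pi.smul_apply, Finset.sum_apply, smul_eq_mul, Pi.sub_apply,
    coefA_sub_one fun σ q => Q P S m σ q ρ]
  set U := P.a (m + 2) * (ph q / S.r1 (m + 2) *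
      (P.c (m + 2) * Q P S m σ q ρ - P.d (m + 2) * Q P S m σ (q - 1) ρ)) -
    P.b (m + 2) * (ph (q - 1) / S.r1 (m + 2) *
      (P.c (m + 2) * Q P S m σ (q - 1) ρ - P.d (m + 2) * Q P S m σ (q - 1 - 1) ρ)) with hU
  -- The coefficient of `Ψ_σ ⊗ ψ_q` in `A (X) Ψ_ρ`, now to be interpolated at the zeros belonging to
  -- `ρ` instead of `σ`.
  set p : ℂ[X] := coefA P S (fun σ q => Q P S m σ q ρ) σ q +
    C (P.kap (m + 2)) * (X * coefA P S (fun σ q => Q P S m σ q ρ) σ (q - 1)) +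
    C U * betaPoly S σ with hp
  have hdeg : p.natDegree ≤ m + 1 + 1 := by
    refine (natDegree_add_le _ _).trans (max_le ((natDegree_add_le _ _).trans (max_le ?_ ?_)) ?_)
    · exact (natDegree_interp_le _ _ _ _).trans (Nat.le_succ _)
    · refine (natDegree_C_mul_le _ _).trans (natDegree_mul_le.trans ?_)
      rw [natDegree_X, add_comm]
      exact Nat.succ_le_succ (natDegree_interp_le _ _ _ _)
    · exact (natDegree_C_mul_le _ _).trans ((natDegree_betaPoly_le σ).trans (Nat.le_succ _))
  have hK : ∏ j ∈ Finset.Icc 1 (m + 1 + 1), P.kap j =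
      (∏ j ∈ Finset.Icc 1 (m + 1), P.kap j) * P.kap (m + 2) :=
    Finset.prod_Icc_succ_top (by omega) P.kap
  -- Only the summand with `ϰ_{m+2} X` reaches this degree.
  have hcoeff : p.coeff (m + 1 + 1) =
      (∏ j ∈ Finset.Icc 1 (m + 1 + 1), P.kap j) * Q P S m σ q (raise ρ 0) := by
    rw [hp, coeff_add, coeff_add, coeff_C_mul, coeff_X_mul, coeff_C_mul, coefA,
      coeff_eq_zero_of_natDegree_lt (Nat.lt_succ_of_le (natDegree_interp_le _ _ _ _)),
      coeff_eq_zero_of_natDegree_lt (Nat.lt_succ_of_le (natDegree_betaPoly_le σ)), coefA,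
      coeff_interp, hK, Q_raise_zero]
    ring
  have hzero : p.eval 0 = Q P S m σ q ρ := by
    rw [hp]
    simp only [eval_add, eval_mul, eval_C, eval_X, eval_coefA_zero, eval_betaPoly, beta]
    ring
  have hnode : ∀ k : Fin (m + 1), p.eval (lam S ρ k.succ) =
      phi P S ρ k.succ * Q P S m σ q (raise ρ k.succ) := fun k => by
    have h0 : beta S ρ (lam S ρ k.succ) = 0 := by
      rw [beta_eq, Finset.prod_eq_zero (Finset.mem_univ k) (sub_self _), mul_zero]
    rw [← Q_raise_phi hP hS hm k σ q ρ, ← coefA_node hP hS hm ρ σ q (hν k) h0, ← hU, hp]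
    simp only [eval_add, eval_mul, eval_C, eval_X, eval_betaPoly]
    ring
  have hI := congrArg (eval z) (eq_interp hν hinj hdeg)
  rw [eval_interp, hcoeff, hzero] at hI
  simp only [hnode] at hI
  have hL : p.eval z = (coefA P S (fun σ q => Q P S m σ q ρ) σ q).eval z +
      z * P.kap (m + 1 + 1) * (coefA P S (fun σ q => Q P S m σ q ρ) σ (q - 1)).eval z +
      beta S σ z * U := by
    rw [hp]
    simp only [eval_add, eval_mul, eval_C, eval_X, eval_betaPoly]
    ring
  rw [← hL, hI]
  congr 1
  · ring
  · refine Finset.sum_congr rfl fun k _ => ?_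
    rw [Finset.prod_div_distrib]
    ring

/-! ### The chain with one site, and the conclusion of the induction -/

theorem T_one (z : ℂ) : T (N := N) P 1 z = LOp P 1 (Fin.last 0) z := by
  simp [T, Fin.last]

/-- A single site is treated as the last site after an empty chain, so that the lemmas on the last
tensor factor apply. -/
theorem Psi_zero (ρ : Fin 1 → ZMod N) : Psi P S 0 ρ = tens (fun _ => 1) (psi P S 1 (ρ 0)) := by
  funext γ
  simp [Psi, tens]

omit [NeZero N] in
theorem raise_fin_one (ρ : Fin 1 → ZMod N) : raise ρ 0 0 = ρ 0 + 1 := raise_same ρ 0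

theorem B_Psi_zero (ha : P.a 1 ≠ 0) (hp : Regular N (pSite P S 1)) (h1 : S.r 1 0 = S.r1 1)
    (σ : Fin 1 → ZMod N) (z : ℂ) :
    B P 1 z (Psi P S 0 σ) = beta S σ z • Psi P S 0 σ := by
  rw [B, T_one, Psi_zero]
  funext γ
  have h := psi_eigen P S ha hp (σ 0) (γ (Fin.last 0))
  simp only [LOp, Matrix.of_apply, Matrix.cons_val_zero, Matrix.cons_val_one,
    Matrix.cons_val_fin_one, LinearMap.smul_apply, Module.End.mul_apply, LinearMap.sub_apply,
    Module.End.one_apply, vOp_last_tens, psi_sub_one, map_sub, map_smul, uInv_last_tens,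
    Pi.smul_apply, Pi.sub_apply, smul_eq_mul, tens, beta, Finset.univ_eq_empty, Finset.prod_empty]
  have h1' : S.r (0 + 1) 0 = S.r1 1 := h1
  rw [h1']
  linear_combination z * h

theorem A_Psi_zero : ActionA N P S 0 := by
  intro ρ z
  rw [A, T_one, Psi_zero, Psi_zero, raise_fin_one]
  have h : vOp (0 : Fin 1) (tens (fun _ => 1) (psi P S 1 (ρ 0))) =
      tens (fun _ => 1) (psi P S 1 (ρ 0 + 1)) := by
    rw [← psi_sub_one]
    exact vOp_last_tens _ _
  simp [LOp, h]

theorem Psi_zero_ne_zero (σ : Fin 1 → ZMod N) : Psi P S 0 σ ≠ 0 := fun h => by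
  have := congrFun h σ
  simp [Psi, psi, w_zero] at this

theorem action_A_B (hP : Generic N P n) (hS : IsChoice N P S n) (hm : m + 1 ≤ n) :
    ActionA N P S m ∧ ∀ (σ : Fin (m + 1) → ZMod N) z,
      Module.End.HasEigenvector (B P (m + 1) z) (beta S σ z) (Psi P S m σ) := by
  induction m with
  | zero =>
    exact ⟨A_Psi_zero, fun σ z => ⟨Module.End.mem_eigenspace_iff.mpr (B_Psi_zero
      (hP.a_ne 1 le_rfl hm) (hP.regular_pSite hS le_rfl hm) hS.r_one σ z), Psi_zero_ne_zero σ⟩⟩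
  | succ m ih =>
    obtain ⟨hA, hB⟩ := ih (by omega)
    refine ⟨A_Psi_succ hP hS hm hA hB, fun σ z => ⟨Module.End.mem_eigenspace_iff.mpr
      (B_Psi_succ hP hS hm hA hB σ z), fun h => ?_⟩⟩
    -- If `Ψ` vanished, independence would force every coefficient `Q` to vanish; the one at `σ =
    -- 0`, `q = 0` contradicts this.
    have := comb_injective (linearIndependent_Psi hP hS (by omega) hB)
      (linearIndependent_psi (hP.a_ne _ (by omega) hm) (hP.r1_ne hS (by omega) hm)
        (hP.regular_pSite hS (by omega) hm)) h
    exact Q_ne_zero hP hS hm 0 0 σ (congrFun (congrFun this 0) 0)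

theorem V_Psi (m : ℕ) (ρ : Fin (m + 1) → ZMod N) :
    V N (m + 1) (Psi P S m ρ) = Psi P S m (raise ρ 0) := by
  induction m with
  | zero =>
    rw [Psi_zero, Psi_zero, raise_fin_one, ← psi_sub_one, ← vOp_last_tens]
    simp [V, Fin.last]
  | succ m ih =>
    rw [Psi_succ, Psi_succ, V_succ, Module.End.mul_apply, vOp_comb]
    simp only [Q_raise_zero]
    -- The shift of `σ 0` in the coefficients is moved back onto the vectors, where the induction
    -- hypothesis recognizes it as the action of the shorter `V`.
    rw [← sum_smul_raise (P := P) (S := S) (fun σ q => Q P S m σ (q - 1) ρ) 0]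
    simp only [comb_apply, map_sum, map_smul, liftHom_tens, ih]

theorem A_at_node (hP : Generic N P n) (hS : IsChoice N P S n) (hm : m + 1 ≤ n)
    (ρ : Fin (m + 1) → ZMod N) (k : Fin m) :
    A P (m + 1) (lam S ρ k.succ) (Psi P S m ρ) = phi P S ρ k.succ • Psi P S m (raise ρ k.succ) := by
  have hν := lam_ne_zero (ρ := ρ) (hP.r_ne_zero hS k.succ.2 hm)
  rw [(action_A_B hP hS hm).1 ρ, Finset.prod_eq_zero (Finset.mem_univ k)
    (by rw [div_self hν, sub_self]), Finset.prod_eq_zero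
    (f := fun s : Fin m => lam S ρ k.succ - lam S ρ s.succ) (Finset.mem_univ k) (sub_self _),
    mul_zero, zero_smul, zero_smul, zero_add, zero_add, Finset.sum_eq_single k]
  · rw [div_self hν, Finset.prod_eq_one, one_mul, one_mul]
    intro s hs
    refine div_self (sub_ne_zero.mpr fun h => Finset.ne_of_mem_erase hs ?_)
    exact (lam_injective hP hS hm ρ ρ h).1.symm
  · intro j _ hj
    rw [Finset.prod_eq_zero (Finset.mem_erase.mpr ⟨hj.symm, Finset.mem_univ k⟩)
      (by rw [sub_self, zero_div]), zero_mul, zero_mul, zero_smul]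
  · simp

end Chain

end BBS

end

/-- The eigenvectors `Ψ_ρ` of `B` for the inhomogeneous chain with `n + 1` sites. -/
theorem theorem1 (N : ℕ) [NeZero N] (hN : 2 ≤ N) (n : ℕ) (P : BBS.Params) (S : BBS.Choice)
    (hP : BBS.Generic N P (n + 1)) (hS : BBS.IsChoice N P S (n + 1)) :
    -- the points that enter the construction lie on the Fermat curve and are nondegenerate
    ((∀ m, 1 ≤ m → m ≤ n + 1 → BBS.Regular N (BBS.pSite P S m)) ∧
      (∀ m, 2 ≤ m → m ≤ n + 1 →
        BBS.Regular N (BBS.pZero P S m) ∧ BBS.Regular N (BBS.pTil P S m)) ∧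
      (∀ m l, 1 ≤ l → l < m → m ≤ n →
        BBS.Regular N (BBS.pPt P S m l) ∧ BBS.Regular N (BBS.pTilPair P S m l) ∧
        (∀ k, 1 ≤ k → k ≤ m → BBS.Regular N (BBS.pPair S (m + 1) k m l)) ∧
        (∀ j, 1 ≤ j → j < m → j ≠ l → BBS.Regular N (BBS.pPair S m l m j)))) ∧
    ∀ ρ : Fin (n + 1) → ZMod N,
      -- `Ψ_ρ` is an eigenvector of `B (z)`, for every `z`
      (∀ z : ℂ, Module.End.HasEigenvector (BBS.B P (n + 1) z)
        (z * (S.r (n + 1) 0 * BBS.ph (-ρ 0)) *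
          ∏ k : Fin n, (z + S.r (n + 1) (k + 1) * BBS.ph (-ρ k.succ)))
        (BBS.Psi P S n ρ)) ∧
      -- the action of `A (z)` on `Ψ_ρ`, for every `z`
      (∀ z : ℂ, BBS.A P (n + 1) z (BBS.Psi P S n ρ) =
        (∏ s : Fin n, (1 - z / BBS.lam S ρ s.succ)) • BBS.Psi P S n ρ +
        (z * (∏ j ∈ Finset.Icc 1 (n + 1), P.kap j) * ∏ s : Fin n, (z - BBS.lam S ρ s.succ)) •
          BBS.Psi P S n (BBS.raise ρ 0) +
        ∑ k : Fin n,
          ((∏ s ∈ Finset.univ.erase k,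
              (z - BBS.lam S ρ s.succ) / (BBS.lam S ρ k.succ - BBS.lam S ρ s.succ)) *
            (z / BBS.lam S ρ k.succ) * BBS.phi P S ρ k.succ) •
          BBS.Psi P S n (BBS.raise ρ k.succ)) ∧
      -- at its zeros, `A` shifts the corresponding component of `ρ`
      (∀ k : Fin n, BBS.A P (n + 1) (BBS.lam S ρ k.succ) (BBS.Psi P S n ρ) =
        BBS.phi P S ρ k.succ • BBS.Psi P S n (BBS.raise ρ k.succ)) ∧
      -- the charge rotation operator shifts the zeroth component of `ρ`
      BBS.V N (n + 1) (BBS.Psi P S n ρ) = BBS.Psi P S n (BBS.raise ρ 0) := by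
  refine ⟨⟨fun m h1 h2 => hP.regular_pSite hS h1 h2, fun m h1 h2 => ?_, fun m l h1 h2 h3 =>
    ⟨hP.regular_pPt hS h1 h2 (by omega), hP.regular_pTilPair hS h1 h2 (by omega),
      fun k h4 h5 => hP.regular_pPair hS h1 h2 h4 h5 (by omega),
      fun j h4 h5 h6 => hP.regular_pPair_same hS h1 h2 h4 h5 (by omega) h6⟩⟩, fun ρ =>
    ⟨fun z => (BBS.action_A_B hP hS le_rfl).2 ρ z, fun z => (BBS.action_A_B hP hS le_rfl).1 ρ z,
      fun k => BBS.A_at_node hP hS le_rfl ρ k, BBS.V_Psi n ρ⟩⟩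
  obtain ⟨k, rfl⟩ : ∃ k, m = k + 2 := ⟨m - 2, by omega⟩
  exact ⟨hP.regular_pZero hS h2, hP.regular_pTil hS h2⟩
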